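/- Let $\mathfrak g$ be a finite-dimensional simple Lie algebra over $\mathbb C$ with Cartan subalgebra $\mathfrak h$, root system $R$, simple roots $\alpha_i$ and simple coroots $h_i$ ($i\in I$). Let $Q^+$ be the set of non-negative integer combinations of the simple roots, put $R^+=R\cap Q^+$ and $\mathfrak n^+=\bigoplus_{\alpha\in R^+}\mathfrak g_\alpha$, and let $x_i^-$ be a non-zero vector of $\mathfrak g_{-\alpha_i}$. Let $P^+$ be the set of $\lambda\in\mathfrak h^*$ with $\lambda(h_i)\in\mathbb Z_{\ge 0}$ for all $i\in I$. Let $A$ be a commutative associative $\mathbb C$-algebra with unit; $\mathfrak g\otimes A$ is a Lie algebra with $[x\otimes a,y\otimes b]=[x,y]\otimes ab$, and $x\in\mathfrak g$ is identified with $x\otimes 1$. For a $\mathfrak g\otimes A$-module $V$ and $\mu\in\mathfrak h^*$ put $V_\mu=\{v\in V: hv=\mu(h)v \text{ for all } h\in\mathfrak h\}$. Fix $\lambda\in P^+$. Let $\mathcal I_A^\lambda$ be the full subcategory of the category of $\mathfrak g\otimes A$-modules consisting of those $V$ that are locally finite-dimensional over $\mathfrak g$ (every vector lies in a finite-dimensional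 $\mathfrak g$-submodule) and satisfy $\mu\in\lambda-Q^+$ whenever $V_\mu\neq 0$; it is an abelian category. Let $W_A(\lambda)$ be the global Weyl module: the $\mathfrak g\otimes A$-module generated by $w_\lambda$ with defining relations $$(\mathfrak n^+\otimes A)w_\lambda=0,\qquad hw_\lambda=\lambda(h)w_\lambda,\qquad (x_i^-)^{\lambda(h_i)+1}w_\lambda=0\qquad(h\in\mathfrak h,\ i\in I).$$ Let $\mathbf A_\lambda$ be the quotient of $U(\mathfrak h\otimes A)$ by the annihilator of $w_\lambda$ in it. It is a commutative algebra that acts on $W_A(\lambda)$ on the right by $(uw_\lambda)c=ucw_\lambda$ for $u\in U(\mathfrak g\otimes A)$, $c\in U(\mathfrak h\otimes A)$. For an $\mathbf A_\lambda$-module $M$ put $\mathbf W_A^\lambda M=W_A(\lambda)\otimes_{\mathbf A_\lambda}M$, and for $V\in\mathcal I_A^\lambda$ let $\mathbf R_A^\lambda V$ be the weight space $V_\lambda$ with the $\mathbf A_\lambda$-module structure induced by the action of $U(\mathfrak h\otimes A)$. A local Weyl module is a module $\mathbf W_A^\lambda M$ with $M$ a simple $\mathbf A_\lambda$-module. **Theorem.**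 Let $V\in\mathcal I_A^\lambda$, and consider the condition $$(\ast)\qquad \operatorname{Hom}_{\mathcal I_A^\lambda}(V,U)=0\ \text{ and }\ \operatorname{Ext}^1_{\mathcal I_A^\lambda}(V,U)=0\quad\text{for every } U\in\mathcal I_A^\lambda\text{ with }U_\lambda=0.$$ Then: 1. $V\cong\mathbf W_A^\lambda\mathbf R_A^\lambda V$ if and only if $(\ast)$ holds. 2. $V\cong\mathbf W_A^\lambda M$ for some $\mathbf A_\lambda$-module $M$ if and only if $(\ast)$ holds. 3. $V\cong\mathbf W_A^\lambda M$ for some simple $\mathbf A_\lambda$-module $M$ (that is, $V$ is a local Weyl module) if and only if $\mathbf R_A^\lambda V$ is a simple $\mathbf A_\lambda$-module and $(\ast)$ holds. -/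

import Mathlib

open scoped TensorProduct
open LieAlgebra LieAlgebra.IsKilling CategoryTheory

universe u

namespace CurrentAlgebra
noncomputable section

set_option linter.unusedSectionVars false

attribute [local instance] LieRing.ofAssociativeRing

section Envelope

variable (𝔤 A : Type u) [LieRing 𝔤] [LieAlgebra ℂ 𝔤] [CommRing A] [Algebra ℂ A]

/-- The universal enveloping algebra `U(𝔤 ⊗ A)`. Left modules over it are the same thing as
`𝔤 ⊗ A`-modules. -/
abbrev Env : Type u := UniversalEnvelopingAlgebra ℂ (A ⊗[ℂ] 𝔤)

variable {𝔤 A}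

/-- The element `x ⊗ a` of `𝔤 ⊗ A`, inside `U(𝔤 ⊗ A)`. The Lie algebra `𝔤` is identified with
the elements `x ⊗ 1`. -/
def cur (x : 𝔤) (a : A) : Env 𝔤 A := UniversalEnvelopingAlgebra.ι ℂ (a ⊗ₜ[ℂ] x)

lemma cur_mul_cur (x y : 𝔤) (a b : A) :
    cur x a * cur y b = cur y b * cur x a + cur ⁅x, y⁆ (a * b) := by
  have h := (UniversalEnvelopingAlgebra.ι ℂ : A ⊗[ℂ] 𝔤 →ₗ⁅ℂ⁆ _).map_lie (a ⊗ₜ[ℂ] x) (b ⊗ₜ[ℂ] y)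
  rw [LieAlgebra.ExtendScalars.bracket_tmul, LieRing.of_associative_ring_bracket] at h
  simp only [cur]
  rw [h]; abel

lemma cur_smul (c : ℂ) (x : 𝔤) (a : A) : cur (c • x) a = c • cur x a := by
  simp only [cur, TensorProduct.tmul_smul, map_smul]

lemma cur_zero (a : A) : cur (0 : 𝔤) a = 0 := by
  simp only [cur, TensorProduct.tmul_zero, map_zero]

lemma cur_add (x y : 𝔤) (a : A) : cur (x + y) a = cur x a + cur y a := by
  simp only [cur, TensorProduct.tmul_add, map_add]

/-- The action of `𝔤` on a `𝔤 ⊗ A`-module. -/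
@[reducible] def lieRingModule (V : Type u) [AddCommGroup V] [Module (Env 𝔤 A) V] :
    LieRingModule 𝔤 V where
  bracket x v := (cur x 1 : Env 𝔤 A) • v
  add_lie x y v := by simp [cur_add, add_smul]
  lie_add x v w := by simp
  leibniz_lie x y v := by
    simp only [← mul_smul]
    rw [cur_mul_cur, add_smul, mul_one, add_comm]

end Envelope

section Integrable

variable {𝔤 A : Type u} [LieRing 𝔤] [LieAlgebra ℂ 𝔤] [CommRing A] [Algebra ℂ A]

open scoped ModuleCat in
/-- A `𝔤 ⊗ A`-module is integrable over `𝔤` if it is locally finite-dimensional as a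
`𝔤`-module: every vector lies in a finite-dimensional `𝔤`-stable subspace. -/
def IsIntegrable (V : ModuleCat.{u} (Env 𝔤 A)) : Prop :=
  ∀ v : V, ∃ F : Submodule ℂ V, FiniteDimensional ℂ F ∧
    (∀ (x : 𝔤), ∀ m ∈ F, (cur x 1 : Env 𝔤 A) • m ∈ F) ∧ v ∈ F

open scoped ModuleCat in
lemma IsIntegrable.exists_lieSubmodule {V : ModuleCat.{u} (Env 𝔤 A)} (hV : IsIntegrable V)
    (v : V) : letI := lieRingModule (𝔤 := 𝔤) (A := A) V
      ∃ F : LieSubmodule ℂ 𝔤 V, FiniteDimensional ℂ F ∧ v ∈ F := by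
  obtain ⟨F, h1, h2, h3⟩ := hV v
  let := lieRingModule (𝔤 := 𝔤) (A := A) V
  exact ⟨{ F with lie_mem := fun {x m} hm ↦ h2 x m hm }, h1, h3⟩

open scoped ModuleCat in
lemma lieModule (V : ModuleCat.{u} (Env 𝔤 A)) :
    let := lieRingModule (𝔤 := 𝔤) (A := A) V
    LieModule ℂ 𝔤 V := by
  let := lieRingModule (𝔤 := 𝔤) (A := A) V
  refine ⟨fun t x m ↦ ?_, fun t x m ↦ ?_⟩
  · change (cur (t • x) 1 : Env 𝔤 A) • m = t • (cur x 1 : Env 𝔤 A) • m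
    rw [cur_smul, smul_assoc]
  · change (cur x 1 : Env 𝔤 A) • t • m = t • (cur x 1 : Env 𝔤 A) • m
    rw [smul_comm]

open scoped ModuleCat in
lemma IsIntegrable.of_injective {V V' : ModuleCat.{u} (Env 𝔤 A)} (f : V →ₗ[Env 𝔤 A] V')
    (hf : Function.Injective f) (hV : IsIntegrable V') : IsIntegrable V := by
  intro v
  obtain ⟨F, h1, h2, h3⟩ := hV (f v)
  refine ⟨F.comap (f.restrictScalars ℂ), ?_, fun x m hm ↦ ?_, h3⟩
  · let g : F.comap (f.restrictScalars ℂ) →ₗ[ℂ] F :=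
      (f.restrictScalars ℂ).restrict fun _ h ↦ h
    refine FiniteDimensional.of_injective g fun a b hab ↦ ?_
    exact Subtype.ext (hf (congrArg Subtype.val hab))
  · change f (_ • m) ∈ F
    rw [map_smul]
    exact h2 x _ hm

open scoped ModuleCat in
lemma IsIntegrable.of_surjective {V V' : ModuleCat.{u} (Env 𝔤 A)} (f : V →ₗ[Env 𝔤 A] V')
    (hf : Function.Surjective f) (hV : IsIntegrable V) : IsIntegrable V' := by
  intro v'
  obtain ⟨v, rfl⟩ := hf v'
  obtain ⟨F, h1, h2, h3⟩ := hV v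
  refine ⟨F.map (f.restrictScalars ℂ), inferInstance, ?_, v, h3, rfl⟩
  rintro x _ ⟨m, hm, rfl⟩
  exact ⟨_, h2 x m hm, map_smul f _ m⟩

open scoped ModuleCat in
lemma IsIntegrable.of_pair {V V₁ V₂ : ModuleCat.{u} (Env 𝔤 A)} (f₁ : V →ₗ[Env 𝔤 A] V₁)
    (f₂ : V →ₗ[Env 𝔤 A] V₂) (hf : ∀ v, f₁ v = 0 → f₂ v = 0 → v = 0)
    (h₁ : IsIntegrable V₁) (h₂ : IsIntegrable V₂) : IsIntegrable V := by
  intro v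
  obtain ⟨F, a1, a2, a3⟩ := h₁ (f₁ v)
  obtain ⟨G, b1, b2, b3⟩ := h₂ (f₂ v)
  refine ⟨F.comap (f₁.restrictScalars ℂ) ⊓ G.comap (f₂.restrictScalars ℂ), ?_,
    fun x m hm ↦ ⟨?_, ?_⟩, a3, b3⟩
  · let g : ↥(F.comap (f₁.restrictScalars ℂ) ⊓ G.comap (f₂.restrictScalars ℂ)) →ₗ[ℂ] F × G :=
      (((f₁.restrictScalars ℂ).restrict fun _ h ↦ h).comp (Submodule.inclusion inf_le_left)).prod
        (((f₂.restrictScalars ℂ).restrict fun _ h ↦ h).comp (Submodule.inclusion inf_le_right))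
    refine FiniteDimensional.of_injective g ((injective_iff_map_eq_zero g).2 fun a ha ↦ ?_)
    have e1 := congrArg (fun p ↦ (p.1 : V₁)) ha
    have e2 := congrArg (fun p ↦ (p.2 : V₂)) ha
    exact Subtype.ext (hf _ e1 e2)
  · change f₁ (_ • m) ∈ F
    rw [map_smul]
    exact a2 x _ hm.1
  · change f₂ (_ • m) ∈ G
    rw [map_smul]
    exact b2 x _ hm.2

end Integrable

section Cartan

variable {𝔤 : Type u} [LieRing 𝔤] [LieAlgebra ℂ 𝔤] [FiniteDimensional ℂ 𝔤]
  [LieAlgebra.IsSimple ℂ 𝔤] (H : LieSubalgebra ℂ 𝔤) [H.IsCartanSubalgebra]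
  (A : Type u) [CommRing A] [Algebra ℂ A]

lemma cur_comm (h h' : H) (a b : A) :
    (cur (h : 𝔤) a : Env 𝔤 A) * cur (h' : 𝔤) b = cur (h' : 𝔤) b * cur (h : 𝔤) a := by
  have : ⁅(h : 𝔤), (h' : 𝔤)⁆ = 0 := by
    rw [← LieSubalgebra.coe_bracket, trivial_lie_zero H H h h']; rfl
  rw [cur_mul_cur, this, cur_zero, add_zero]

/-- `U(𝔥 ⊗ A)`, as the subalgebra of `U(𝔤 ⊗ A)` generated by `𝔥 ⊗ A`. -/
abbrev CartanEnv : Subalgebra ℂ (Env 𝔤 A) :=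
  Algebra.adjoin ℂ (Set.range fun p : H × A ↦ cur (p.1 : 𝔤) p.2)

instance : CommRing (CartanEnv H A) :=
  { (inferInstance : Ring (CartanEnv H A)) with
    mul_comm := (Algebra.isMulCommutative_adjoin ℂ (by
      rintro _ ⟨p, rfl⟩ _ ⟨q, rfl⟩
      exact cur_comm H A p.1 q.1 p.2 q.2) : IsMulCommutative (CartanEnv H A)).is_comm.comm }

lemma cur_mem (h : H) (a : A) : (cur (h : 𝔤) a : Env 𝔤 A) ∈ CartanEnv H A :=
  Algebra.subset_adjoin ⟨(h, a), rfl⟩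

/-- The weight space `V_μ = {v | h v = μ(h) v for all h ∈ 𝔥}` of a `𝔤 ⊗ A`-module `V`; it is a
module for `U(𝔥 ⊗ A)`. -/
def weightSpace (V : Type u) [AddCommGroup V] [Module (Env 𝔤 A) V] (μ : Module.Dual ℂ H) :
    Submodule (CartanEnv H A) V where
  carrier := {v | ∀ h : H, (cur (h : 𝔤) 1 : Env 𝔤 A) • v = algebraMap ℂ (Env 𝔤 A) (μ h) • v}
  add_mem' {v w} hv hw h := by rw [smul_add, hv h, hw h, smul_add]
  zero_mem' h := by simp
  smul_mem' c v hv h := by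
    have e : (cur (h : 𝔤) 1 : Env 𝔤 A) * (c : Env 𝔤 A) = (c : Env 𝔤 A) * cur (h : 𝔤) 1 :=
      congrArg Subtype.val (mul_comm (⟨_, cur_mem H A h 1⟩ : CartanEnv H A) c)
    change (cur (h : 𝔤) 1 : Env 𝔤 A) • (c : Env 𝔤 A) • v = _ • (c : Env 𝔤 A) • v
    rw [← mul_smul, e, mul_smul, hv h, ← mul_smul, ← mul_smul, Algebra.commutes]

open scoped ModuleCat in
lemma weightSpace_ne_bot_of_surjective {V V' : ModuleCat.{u} (Env 𝔤 A)}
    (f : V →ₗ[Env 𝔤 A] V') (hf : Function.Surjective f) (hV : IsIntegrable V)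
    (μ : Module.Dual ℂ H) (hμ : weightSpace H A V' μ ≠ ⊥) : weightSpace H A V μ ≠ ⊥ := by
  obtain ⟨v', hv', hv0⟩ := (Submodule.ne_bot_iff _).1 hμ
  let i1 := lieRingModule (𝔤 := 𝔤) (A := A) V
  have i2 := lieModule (𝔤 := 𝔤) (A := A) V
  let i3 := lieRingModule (𝔤 := 𝔤) (A := A) V'
  have i4 := lieModule (𝔤 := 𝔤) (A := A) V'
  obtain ⟨v, rfl⟩ := hf v'
  obtain ⟨F, hF, hvF⟩ := hV.exists_lieSubmodule v
  let g : F →ₗ⁅ℂ, H⁆ V' :=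
    { (f.restrictScalars ℂ).comp F.toSubmodule.subtype with
      map_lie' := fun {x m} ↦ map_smul f (cur (x : 𝔤) 1) (m : V) }
  by_contra hbot
  have hgen : LieModule.genWeightSpace F (μ : H → ℂ) = ⊥ := by
    by_contra hne
    obtain ⟨m, hm0, hm⟩ := LieModule.exists_forall_lie_eq_smul ℂ H F
      (⟨μ, hne⟩ : LieModule.Weight ℂ H F)
    refine hm0 (Subtype.ext ?_)
    have : (m : V) ∈ weightSpace H A V μ := fun h ↦ by
      rw [algebraMap_smul]
      exact congrArg Subtype.val (hm h)
    rw [hbot] at this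
    exact (Submodule.mem_bot _).1 this
  have htop := LieModule.iSup_genWeightSpace_eq_top ℂ H F
  have hv : (⟨v, hvF⟩ : F) ∈ ⨆ χ : H → ℂ, ⨆ _ : χ ≠ μ, LieModule.genWeightSpace F χ := by
    have : (⟨v, hvF⟩ : F) ∈ ⨆ χ : H → ℂ, LieModule.genWeightSpace F χ := by
      rw [htop]; exact LieSubmodule.mem_top _
    refine (iSup_le fun χ ↦ ?_ : (⨆ χ : H → ℂ, LieModule.genWeightSpace F χ) ≤ _) this
    by_cases h : χ = μ
    · rw [h, hgen]; exact bot_le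
    · exact le_iSup₂_of_le χ h le_rfl
  have hg : f v ∈ ⨆ χ : H → ℂ, ⨆ _ : χ ≠ μ, LieModule.genWeightSpace V' χ := by
    have : g ⟨v, hvF⟩ ∈ LieSubmodule.map g
        (⨆ χ : H → ℂ, ⨆ _ : χ ≠ μ, LieModule.genWeightSpace F χ) := LieSubmodule.mem_map_of_mem hv
    simp only [LieSubmodule.map_iSup] at this
    exact iSup₂_mono (fun χ _ ↦ LieModule.map_genWeightSpace_le g) this
  have hμ' : f v ∈ LieModule.genWeightSpace V' (μ : H → ℂ) := by
    refine LieModule.weightSpace_le_genWeightSpace V' _ ?_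
    rw [LieModule.mem_weightSpace]
    intro h
    rw [← algebraMap_smul (Env 𝔤 A)]
    exact hv' h
  have hind := LieModule.iSupIndep_genWeightSpace ℂ H V' (μ : H → ℂ)
  rw [disjoint_iff] at hind
  have : f v ∈ LieModule.genWeightSpace V' (μ : H → ℂ) ⊓
      ⨆ χ : H → ℂ, ⨆ _ : χ ≠ μ, LieModule.genWeightSpace V' χ := ⟨hμ', hg⟩
  rw [hind] at this
  exact hv0 ((LieSubmodule.mem_bot _).1 this)

end Cartan

section Category

variable {𝔤 : Type u} [LieRing 𝔤] [LieAlgebra ℂ 𝔤] [FiniteDimensional ℂ 𝔤]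
  [LieAlgebra.IsSimple ℂ 𝔤] {H : LieSubalgebra ℂ 𝔤} [H.IsCartanSubalgebra]
  (b : (rootSystem H).Base) (A : Type u) [CommRing A] [Algebra ℂ A]

/-- The cone `Q⁺` of non-negative integer combinations of simple roots. -/
def posCone : AddSubmonoid (Module.Dual ℂ H) :=
  AddSubmonoid.closure ((rootSystem H).root '' b.support)

/-- `λ` is a dominant integral weight: `λ(h_i)` is a non-negative integer for every simple
coroot `h_i`. -/
def IsDominantIntegral (lam : Module.Dual ℂ H) : Prop :=
  ∀ i ∈ b.support, ∃ n : ℕ, lam ((rootSystem H).coroot i) = n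

/-- The objects of `I_A^λ`: the `𝔤 ⊗ A`-modules that are integrable over `𝔤` and all of whose
weights lie in `λ - Q⁺`. -/
def boundedIntegrable (lam : Module.Dual ℂ H) : ObjectProperty (ModuleCat.{u} (Env 𝔤 A)) :=
  fun V ↦ IsIntegrable V ∧
    ∀ μ : Module.Dual ℂ H, weightSpace H A V μ ≠ ⊥ → lam - μ ∈ posCone b

/-- The category `I_A^λ`, a full subcategory of the category of `𝔤 ⊗ A`-modules. -/
abbrev BoundedCat (lam : Module.Dual ℂ H) : Type (u + 1) :=
  (boundedIntegrable b A lam).FullSubcategory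

variable {A} (lam : Module.Dual ℂ H)

instance : (boundedIntegrable b A lam).IsClosedUnderSubobjects where
  prop_of_mono {X Y} f hf hY := by
    have hinj : Function.Injective f.hom := (ModuleCat.mono_iff_injective f).1 hf
    refine ⟨hY.1.of_injective f.hom hinj, fun μ hμ ↦ hY.2 μ ?_⟩
    obtain ⟨v, hv, hv0⟩ := (Submodule.ne_bot_iff _).1 hμ
    refine (Submodule.ne_bot_iff _).2 ⟨f.hom v, fun h ↦ ?_, fun h ↦ hv0 (hinj (by simpa using h))⟩
    rw [← map_smul, hv h, map_smul]

instance : (boundedIntegrable b A lam).IsClosedUnderQuotients where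
  prop_of_epi {X Y} f hf hX := by
    have hsurj : Function.Surjective f.hom := (ModuleCat.epi_iff_surjective f).1 hf
    exact ⟨hX.1.of_surjective f.hom hsurj, fun μ hμ ↦
      hX.2 μ (weightSpace_ne_bot_of_surjective H A f.hom hsurj hX.1 μ hμ)⟩

open scoped ModuleCat in
instance : (boundedIntegrable b A lam).ContainsZero where
  exists_zero := by
    refine ⟨ModuleCat.of (Env 𝔤 A) PUnit, ModuleCat.isZero_of_subsingleton _, fun v ↦ ?_,
      fun μ hμ ↦ ?_⟩
    · exact ⟨⊥, inferInstance, fun x m hm ↦ Subsingleton.elim _ _, Subsingleton.elim _ _⟩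
    · obtain ⟨v, hv, hv0⟩ := (Submodule.ne_bot_iff _).1 hμ
      exact absurd (Subsingleton.elim _ _) hv0

instance : (boundedIntegrable b A lam).IsClosedUnderBinaryProducts where
  limitsOfShape_le := by
    rintro X ⟨p⟩
    let f₁ : X ⟶ _ := p.π.app ⟨Limits.WalkingPair.left⟩
    let f₂ : X ⟶ _ := p.π.app ⟨Limits.WalkingPair.right⟩
    have hf : ∀ v : X, f₁.hom v = 0 → f₂.hom v = 0 → v = 0 := by
      intro v h1 h2
      have : ModuleCat.ofHom (LinearMap.toSpanSingleton (Env 𝔤 A) X v) = 0 := by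
        refine p.isLimit.hom_ext ?_
        rintro ⟨_ | _⟩
        · ext; simpa using h1
        · ext; simpa using h2
      simpa using congrArg (fun g ↦ g.hom (1 : Env 𝔤 A)) this
    have h1 := p.prop_diag_obj ⟨Limits.WalkingPair.left⟩
    have h2 := p.prop_diag_obj ⟨Limits.WalkingPair.right⟩
    refine ⟨h1.1.of_pair f₁.hom f₂.hom hf h2.1, fun μ hμ ↦ ?_⟩
    obtain ⟨v, hv, hv0⟩ := (Submodule.ne_bot_iff _).1 hμ
    by_cases h : f₁.hom v = 0
    · refine h2.2 μ ((Submodule.ne_bot_iff _).2 ⟨f₂.hom v, fun x ↦ ?_, fun h' ↦ hv0 (hf v h h')⟩)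
      rw [← map_smul, hv x, map_smul]
    · refine h1.2 μ ((Submodule.ne_bot_iff _).2 ⟨f₁.hom v, fun x ↦ ?_, h⟩)
      rw [← map_smul, hv x, map_smul]

instance : (boundedIntegrable b A lam).IsClosedUnderFiniteProducts :=
  ObjectProperty.IsClosedUnderFiniteProducts.mk'

/-- `I_A^λ` is an abelian category. -/
instance : Abelian (BoundedCat b A lam) := inferInstance

instance : HasExt.{u + 1} (BoundedCat b A lam) := HasExt.standard _

end Category

section Weyl

variable {𝔤 : Type u} [LieRing 𝔤] [LieAlgebra ℂ 𝔤] [FiniteDimensional ℂ 𝔤]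
  [LieAlgebra.IsSimple ℂ 𝔤] {H : LieSubalgebra ℂ 𝔤} [H.IsCartanSubalgebra]
  (b : (rootSystem H).Base) (A : Type u) [CommRing A] [Algebra ℂ A] (lam : Module.Dual ℂ H)

/-- The defining relations of the global Weyl module `W_A(λ)`. -/
inductive WeylRel : Env 𝔤 A → Prop
  /-- `(𝔫⁺ ⊗ A) w_λ = 0`: `x` runs over the root spaces of the positive roots `α ∈ R ∩ Q⁺`. -/
  | raise (α : H.root) (hα : (rootSystem H).root α ∈ posCone b) (x : 𝔤)
      (hx : x ∈ rootSpace H α.1) (a : A) : WeylRel (cur x a)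
  /-- `h w_λ = λ(h) w_λ` for `h ∈ 𝔥`. -/
  | weight (h : H) : WeylRel (cur (h : 𝔤) 1 - algebraMap ℂ (Env 𝔤 A) (lam h))
  /-- `(x_i⁻)^{λ(h_i) + 1} w_λ = 0`: here `y` is any vector of the one-dimensional root space of
  the negative simple root `-α_i`, and `n = λ(h_i)`. -/
  | lower (i : H.root) (hi : i ∈ b.support) (y : 𝔤) (hy : y ∈ rootSpace H (-i.1)) (n : ℕ)
      (hn : lam ((rootSystem H).coroot i) = n) : WeylRel (cur y 1 ^ (n + 1))

/-- The left ideal of `U(𝔤 ⊗ A)` generated by the defining relations of `W_A(λ)`. -/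
def weylIdeal : Submodule (Env 𝔤 A) (Env 𝔤 A) := Submodule.span _ {u | WeylRel b A lam u}

/-- The global Weyl module `W_A(λ)`. -/
def GlobalWeyl : Type u := Env 𝔤 A ⧸ weylIdeal b A lam

instance : AddCommGroup (GlobalWeyl b A lam) :=
  inferInstanceAs (AddCommGroup (Env 𝔤 A ⧸ weylIdeal b A lam))

instance : Module (Env 𝔤 A) (GlobalWeyl b A lam) :=
  inferInstanceAs (Module (Env 𝔤 A) (Env 𝔤 A ⧸ weylIdeal b A lam))

/-- The generator `w_λ` of `W_A(λ)`. -/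
def wLam : GlobalWeyl b A lam := Submodule.Quotient.mk 1

/-- The annihilator of `w_λ` in `U(𝔥 ⊗ A)`. -/
def annW : Ideal (CartanEnv H A) where
  carrier := {u | (u : Env 𝔤 A) • wLam b A lam = 0}
  add_mem' {u v} hu hv := by
    simp only [Set.mem_ofPred_eq, Subalgebra.coe_add, add_smul] at *
    rw [hu, hv, add_zero]
  zero_mem' := by simp
  smul_mem' c u hu := by
    simp only [Set.mem_ofPred_eq, smul_eq_mul, Subalgebra.coe_mul, mul_smul] at *
    rw [hu, smul_zero]

/-- The commutative algebra `𝐀_λ = U(𝔥 ⊗ A) / Ann(w_λ)`. -/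
abbrev ALam : Type u := CartanEnv H A ⧸ annW b A lam


section RightAction

/-! The right action of `U(𝔥 ⊗ A)` on `W_A(λ)`. -/

lemma ring_aux1 {R : Type*} [Ring R] [Algebra ℂ R] {P Q F : R} (c : ℂ) (h1 : Q * F = F * Q)
    (h2 : P * F = F * P + c • Q) (n : ℕ) :
    P * F ^ (n + 1) = F ^ (n + 1) * P + (((n : ℂ) + 1) * c) • (F ^ n * Q) := by
  induction n with
  | zero => simp [h2]
  | succ n ih =>
    have : P * F ^ (n + 1 + 1) = F ^ (n + 1) * (P * F) +
        (((n : ℂ) + 1) * c) • (F ^ n * (Q * F)) := by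
      rw [pow_succ, ← mul_assoc, ih, add_mul, mul_assoc, smul_mul_assoc, mul_assoc]
    rw [this, h1, h2, mul_add, ← mul_assoc, ← mul_assoc, mul_smul_comm, ← pow_succ, ← pow_succ]
    push_cast
    module

lemma ring_aux2 {R : Type*} [Ring R] [Algebra ℂ R] {E P Q F : R} (h1 : Q * F = F * Q)
    (h2 : P * F = F * P + (-2 : ℂ) • Q) (h3 : E * F = F * E + P) (n : ℕ) :
    E * F ^ (n + 2) = F ^ (n + 2) * E + ((n : ℂ) + 2) • (F ^ (n + 1) * P) -
      (((n : ℂ) + 2) * ((n : ℂ) + 1)) • (F ^ n * Q) := by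
  induction n with
  | zero =>
    have : E * F ^ 2 = F * (F * E) + (F * P + (F * P + (-2 : ℂ) • Q)) := by
      rw [pow_two, ← mul_assoc, h3, add_mul, mul_assoc, h3, h2, mul_add, add_assoc]
    rw [zero_add, this, ← mul_assoc, ← pow_two]
    simp only [zero_add, pow_one, pow_zero, one_mul, Nat.cast_zero]
    module
  | succ n ih =>
    have : E * F ^ (n + 1 + 2) = F ^ (n + 2) * (E * F) + ((n : ℂ) + 2) • (F ^ (n + 1) * (P * F)) -
        (((n : ℂ) + 2) * ((n : ℂ) + 1)) • (F ^ n * (Q * F)) := by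
      rw [show n + 1 + 2 = (n + 2) + 1 by ring, pow_succ, ← mul_assoc, ih, sub_mul, add_mul,
        smul_mul_assoc, smul_mul_assoc, mul_assoc, mul_assoc, mul_assoc]
    rw [this, h1, h2, h3, mul_add, mul_add, mul_smul_comm, ← mul_assoc, ← mul_assoc, ← mul_assoc,
      ← pow_succ, ← pow_succ, ← pow_succ]
    push_cast
    module

variable {A}

lemma exists_sl2 (i : H.root) (y : 𝔤) (hy : y ∈ rootSpace H (-i.1)) (hy0 : y ≠ 0) :
    ∃ e ∈ rootSpace H i.1, IsSl2Triple (((rootSystem H).coroot i : H) : 𝔤) e y := by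
  have hi : i.1.IsNonZero := LieSubalgebra.isNonZero_coe_root i
  obtain ⟨h, e, f, ht, he, hf⟩ := exists_isSl2Triple_of_weight_isNonZero hi
  obtain rfl := ht.h_eq_coroot hi he hf
  obtain ⟨c, hc⟩ : ∃ c : ℂ, c • f = y := by
    have h1 := finrank_rootSpace_eq_one (-i.1) hi.neg
    have hf0 : (⟨f, hf⟩ : rootSpace H (-i.1)) ≠ 0 :=
      fun h0 ↦ ht.f_ne_zero (congrArg Subtype.val h0)
    obtain ⟨c, hc⟩ := (finrank_eq_one_iff_of_nonzero' (⟨f, hf⟩ : rootSpace H (-i.1)) hf0).1 h1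
      ⟨y, hy⟩
    exact ⟨c, congrArg Subtype.val hc⟩
  subst hc
  have hc0 : c ≠ 0 := fun h0 ↦ hy0 (by rw [h0, zero_smul])
  refine ⟨c⁻¹ • e, Submodule.smul_mem _ _ he, ht.h_ne_zero, ?_, ?_, ?_⟩
  · rw [smul_lie, lie_smul, smul_smul, inv_mul_cancel₀ hc0, one_smul]
    exact ht.lie_e_f
  · rw [lie_smul]
    change c⁻¹ • ⁅((coroot i.1 : H) : 𝔤), e⁆ = _
    rw [ht.lie_h_e_nsmul, smul_comm]
  · rw [lie_smul]
    change c • ⁅((coroot i.1 : H) : 𝔤), f⁆ = _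
    rw [ht.lie_h_f_nsmul, smul_neg, smul_comm]

lemma cur_lie_cartan_mem {b : (rootSystem H).Base} {lam : Module.Dual ℂ H} (u : Env 𝔤 A)
    (hu : WeylRel b A lam u) (h : H) (a : A) : u * cur (h : 𝔤) a ∈ weylIdeal b A lam := by
  have hgen : ∀ {u}, WeylRel b A lam u → u ∈ weylIdeal b A lam := fun hu ↦ Submodule.subset_span hu
  have hmul : ∀ (x : Env 𝔤 A) {u}, u ∈ weylIdeal b A lam → x * u ∈ weylIdeal b A lam :=
    fun x _ hu ↦ Submodule.smul_mem _ x hu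
  have hsm : ∀ (c : ℂ) {u}, u ∈ weylIdeal b A lam → c • u ∈ weylIdeal b A lam := by
    intro c u hu
    rw [Algebra.smul_def]
    exact hmul _ hu
  induction hu with
  | raise α hα x hx a' =>
    rw [cur_mul_cur]
    refine add_mem (hmul _ (hgen (.raise α hα x hx a'))) (hgen (.raise α hα _ ?_ _))
    rw [← lie_skew]
    exact neg_mem ((rootSpace H α.1).lie_mem (x := h) hx)
  | weight h' =>
    have : (cur (h' : 𝔤) 1 - algebraMap ℂ (Env 𝔤 A) (lam h')) * cur (h : 𝔤) a =
        cur (h : 𝔤) a * (cur (h' : 𝔤) 1 - algebraMap ℂ (Env 𝔤 A) (lam h')) := by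
      rw [sub_mul, mul_sub, cur_comm, Algebra.commutes]
    rw [this]
    exact hmul _ (hgen (.weight h'))
  | lower i hi y hy n hn =>
    by_cases hy0 : y = 0
    · rw [hy0, cur_zero, zero_pow n.succ_ne_zero, zero_mul]
      exact zero_mem _
    obtain ⟨e, he, ht⟩ := exists_sl2 i y hy hy0
    set hc : H := (rootSystem H).coroot i with hhc
    have hF := hgen (.lower i hi y hy n hn)
    have hE := hgen (.raise i (AddSubmonoid.subset_closure ⟨i, hi, rfl⟩) e he a)
    have h1 : (cur y a : Env 𝔤 A) * cur y 1 = cur y 1 * cur y a := by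
      rw [cur_mul_cur, lie_self, cur_zero, add_zero]
    have h2 : (cur (hc : 𝔤) a : Env 𝔤 A) * cur y 1 =
        cur y 1 * cur (hc : 𝔤) a + (-2 : ℂ) • cur y a := by
      rw [cur_mul_cur, ht.lie_lie_smul_f ℂ, ← neg_smul, cur_smul, mul_one]
    have h3 : (cur e a : Env 𝔤 A) * cur y 1 = cur y 1 * cur e a + cur (hc : 𝔤) a := by
      rw [cur_mul_cur, ht.lie_e_f, mul_one]
    have h4 : (cur (h : 𝔤) a : Env 𝔤 A) * cur y 1 =
        cur y 1 * cur (h : 𝔤) a + (-(i.1 h)) • cur y a := by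
      rw [cur_mul_cur, mul_one, ← cur_smul]
      congr 2
      exact lie_eq_smul_of_mem_rootSpace hy h
    have k1 := ring_aux2 h1 h2 h3 n
    have k2 := ring_aux1 (-2) h1 h2 n
    have k3 := ring_aux1 _ h1 h4 n
    have m1 : (cur y 1 : Env 𝔤 A) ^ (n + 1) * cur (hc : 𝔤) a +
        (((n : ℂ) + 1) * (-2)) • (cur y 1 ^ n * cur y a) ∈ weylIdeal b A lam :=
      k2 ▸ hmul _ hF
    have m2 : ((n : ℂ) + 2) • ((cur y 1 : Env 𝔤 A) ^ (n + 1) * cur (hc : 𝔤) a) -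
        (((n : ℂ) + 2) * ((n : ℂ) + 1)) • (cur y 1 ^ n * cur y a) ∈ weylIdeal b A lam := by
      have e1 : (cur e a : Env 𝔤 A) * cur y 1 ^ (n + 2) ∈ weylIdeal b A lam := by
        rw [show n + 2 = 1 + (n + 1) by ring, pow_add, ← mul_assoc]
        exact hmul _ hF
      have e2 : (cur y 1 : Env 𝔤 A) ^ (n + 2) * cur e a ∈ weylIdeal b A lam := hmul _ hE
      have := sub_mem e1 e2
      rw [k1] at this
      convert this using 1
      abel
    have m3 : (cur y 1 : Env 𝔤 A) ^ n * cur y a ∈ weylIdeal b A lam := by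
      have hn2 : ((n : ℂ) + 2) * ((n : ℂ) + 1) ≠ 0 := by
        have a1 : (n : ℂ) + 2 ≠ 0 := by exact_mod_cast (by omega : n + 2 ≠ 0)
        have a2 : (n : ℂ) + 1 ≠ 0 := by exact_mod_cast (by omega : n + 1 ≠ 0)
        exact mul_ne_zero a1 a2
      have := hsm (((n : ℂ) + 2) * ((n : ℂ) + 1))⁻¹ (sub_mem m2 (hsm ((n : ℂ) + 2) m1))
      convert this using 1
      rw [eq_inv_smul_iff₀ hn2]
      module
    have m4 := sub_mem (hmul (cur (h : 𝔤) a) hF) (hsm (((n : ℂ) + 1) * (-(i.1 h))) m3)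
    rw [k3, add_sub_cancel_right] at m4
    exact m4

lemma weylIdeal_mul_mem {b : (rootSystem H).Base} {lam : Module.Dual ℂ H} {u : Env 𝔤 A}
    (hu : u ∈ weylIdeal b A lam) (c : CartanEnv H A) :
    u * (c : Env 𝔤 A) ∈ weylIdeal b A lam := by
  obtain ⟨c, hc⟩ := c
  change u * c ∈ _
  induction hc using Algebra.adjoin_induction generalizing u with
  | mem x hx =>
    obtain ⟨⟨h, a⟩, rfl⟩ := hx
    induction hu using Submodule.span_induction with
    | mem u hu => exact cur_lie_cartan_mem u hu h a
    | zero => rw [zero_mul]; exact zero_mem _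
    | add u v _ _ hu hv => rw [add_mul]; exact add_mem hu hv
    | smul r u _ hu => rw [smul_mul_assoc]; exact Submodule.smul_mem _ r hu
  | algebraMap r => rw [← Algebra.commutes]; exact Submodule.smul_mem _ _ hu
  | add x y _ _ hx hy => rw [mul_add]; exact add_mem (hx hu) (hy hu)
  | mul x y _ _ hx hy => rw [← mul_assoc]; exact hy (hx hu)

variable (A)

/-- The right action of `U(𝔥 ⊗ A)` on `W_A(λ)`: `(u w_λ) c = u c w_λ`. -/
def rightMul : CartanEnv H A →+* Module.End (Env 𝔤 A) (GlobalWeyl b A lam) where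
  toFun c := Submodule.mapQ (weylIdeal b A lam) (weylIdeal b A lam)
    (LinearMap.toSpanSingleton (Env 𝔤 A) (Env 𝔤 A) (c : Env 𝔤 A))
    fun _ hu ↦ weylIdeal_mul_mem hu c
  map_one' := by
    refine LinearMap.ext fun w ↦ ?_
    induction w using Submodule.Quotient.induction_on with
    | H u => exact congrArg Submodule.Quotient.mk (mul_one u)
  map_mul' c d := by
    refine LinearMap.ext fun w ↦ ?_
    induction w using Submodule.Quotient.induction_on with
    | H u =>
      refine congrArg Submodule.Quotient.mk ?_
      change u * ((c * d : CartanEnv H A) : Env 𝔤 A) = u * (d : Env 𝔤 A) * (c : Env 𝔤 A)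
      rw [mul_comm c d, mul_assoc]
      rfl
  map_zero' := by
    refine LinearMap.ext fun w ↦ ?_
    induction w using Submodule.Quotient.induction_on with
    | H u => exact congrArg Submodule.Quotient.mk (mul_zero u)
  map_add' c d := by
    refine LinearMap.ext fun w ↦ ?_
    induction w using Submodule.Quotient.induction_on with
    | H u => exact congrArg Submodule.Quotient.mk (mul_add u (c : Env 𝔤 A) (d : Env 𝔤 A))

lemma rightMul_eq_zero (c : CartanEnv H A) (hc : c ∈ annW b A lam) :
    rightMul b A lam c = 0 := by
  have hc' : (c : Env 𝔤 A) ∈ weylIdeal b A lam := by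
    rw [← mul_one (c : Env 𝔤 A)]
    exact (Submodule.Quotient.mk_eq_zero _).1 hc
  refine LinearMap.ext fun w ↦ ?_
  induction w using Submodule.Quotient.induction_on with
  | H u =>
    exact (Submodule.Quotient.mk_eq_zero _).2 (Submodule.smul_mem (weylIdeal b A lam) u hc')

/-- `W_A(λ)` as a module for the commutative algebra `𝐀_λ`, acting on the right. -/
instance : Module (ALam b A lam) (GlobalWeyl b A lam) :=
  Module.compHom _ (Ideal.Quotient.lift (annW b A lam) (rightMul b A lam)
    (rightMul_eq_zero b A lam))

lemma mk_smul (c : CartanEnv H A) (w : GlobalWeyl b A lam) :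
    (Ideal.Quotient.mk (annW b A lam) c) • w = rightMul b A lam c w := rfl

instance : SMulCommClass (ALam b A lam) (Env 𝔤 A) (GlobalWeyl b A lam) where
  smul_comm c u w := by
    obtain ⟨c, rfl⟩ := Ideal.Quotient.mk_surjective c
    rw [mk_smul, mk_smul, map_smul]

end RightAction

/-- The object `𝐖_A^λ M = W_A(λ) ⊗_{𝐀_λ} M`, a `𝔤 ⊗ A`-module through the left factor. -/
def weylObj (M : ModuleCat.{u} (ALam b A lam)) : ModuleCat.{u} (Env 𝔤 A) :=
  ModuleCat.of (Env 𝔤 A) (GlobalWeyl b A lam ⊗[ALam b A lam] M)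

section Restriction

variable {b lam}

lemma eq_zero_of_posCone {α : Module.Dual ℂ H} (h1 : α ∈ posCone b) (h2 : -α ∈ posCone b) :
    α = 0 := by
  have hli : LinearIndependent ℂ (fun i : b.support ↦ (rootSystem H).root i) :=
    b.linearIndepOn_root
  obtain ⟨φ, hφ⟩ := LinearMap.exists_extend
    ((Module.Basis.span hli).constr ℂ (fun _ : b.support ↦ (1 : ℂ)))
  have hφ1 : ∀ i : b.support, φ ((rootSystem H).root i) = 1 := by
    intro i
    have h := LinearMap.congr_fun hφ (Module.Basis.span hli i)
    rw [Module.Basis.constr_basis] at h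
    rw [← h, LinearMap.comp_apply, Submodule.subtype_apply, Module.Basis.span_apply]
  have key : ∀ x ∈ posCone b, ∃ n : ℕ, φ x = n ∧ (n = 0 → x = 0) := by
    intro x hx
    induction hx using AddSubmonoid.closure_induction with
    | mem x hx =>
      obtain ⟨i, hi, rfl⟩ := hx
      exact ⟨1, by simpa using hφ1 ⟨i, hi⟩, by simp⟩
    | zero => exact ⟨0, by simp, by simp⟩
    | add x y _ _ hx hy =>
      obtain ⟨m, h1, h2⟩ := hx
      obtain ⟨n, h3, h4⟩ := hy
      refine ⟨m + n, by simp [h1, h3], fun h ↦ ?_⟩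
      rw [h2 (by omega), h4 (by omega), add_zero]
  obtain ⟨m, hm, hm0⟩ := key _ h1
  obtain ⟨n, hn, -⟩ := key _ h2
  rw [map_neg, hm] at hn
  have h0 : (m : ℂ) + n = 0 := by rw [← hn]; ring
  have h0' : m + n = 0 := by exact_mod_cast h0
  exact hm0 (by omega)

variable {A}

lemma raise_mem_weightSpace {V : Type u} [AddCommGroup V] [Module (Env 𝔤 A) V]
    {μ : Module.Dual ℂ H} {v : V} (hv : v ∈ weightSpace H A V μ) (α : H.root) (x : 𝔤)
    (hx : x ∈ rootSpace H α.1) (a : A) :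
    (cur x a : Env 𝔤 A) • v ∈ weightSpace H A V (μ + (rootSystem H).root α) := by
  intro h
  have hb : ⁅(h : 𝔤), x⁆ = α.1 h • x := lie_eq_smul_of_mem_rootSpace hx h
  rw [← mul_smul, cur_mul_cur, hb, cur_smul, one_mul, add_smul, mul_smul, hv h, ← mul_smul,
    ← Algebra.commutes, mul_smul, LinearMap.add_apply, map_add, add_smul, Algebra.smul_def,
    mul_smul]
  rfl

open scoped ModuleCat in
lemma lower_pow_smul_eq_zero {V : ModuleCat.{u} (Env 𝔤 A)} (hV : IsIntegrable V) {h e f : 𝔤}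
    (ht : IsSl2Triple h e f) (n : ℕ) {v : V} (hv : (cur h 1 : Env 𝔤 A) • v = (n : ℂ) • v)
    (he : (cur e 1 : Env 𝔤 A) • v = 0) : (cur f 1 ^ (n + 1) : Env 𝔤 A) • v = 0 := by
  by_cases hv0 : v = 0
  · rw [hv0, smul_zero]
  let i1 := lieRingModule (𝔤 := 𝔤) (A := A) V
  have i2 := lieModule (𝔤 := 𝔤) (A := A) V
  obtain ⟨F, hF, hvF⟩ := hV.exists_lieSubmodule v
  have P : ht.HasPrimitiveVectorWith (⟨v, hvF⟩ : F) (n : ℂ) :=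
    { ne_zero := fun h0 ↦ hv0 (congrArg Subtype.val h0)
      lie_h := Subtype.ext hv
      lie_e := Subtype.ext he }
  have h0 := P.pow_toEnd_f_eq_zero_of_eq_nat (n := n) rfl
  have key : ∀ m : ℕ, (((LieModule.toEnd ℂ 𝔤 F f ^ m) ⟨v, hvF⟩ : F) : V) =
      (cur f 1 ^ m : Env 𝔤 A) • v := by
    intro m
    induction m with
    | zero => simp
    | succ m ih =>
      rw [pow_succ', pow_succ', mul_smul, ← ih]
      rfl
  rw [← key, h0]
  rfl

lemma weylIdeal_smul_eq_zero (V : BoundedCat b A lam) {u : Env 𝔤 A}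
    (hu : u ∈ weylIdeal b A lam) {v : V.obj} (hv : v ∈ weightSpace H A V.obj lam) : u • v = 0 := by
  have hraise : ∀ (α : H.root), (rootSystem H).root α ∈ posCone b → ∀ x ∈ rootSpace H α.1,
      ∀ a : A, (cur x a : Env 𝔤 A) • v = 0 := by
    intro α hα x hx a
    by_contra h0
    have h1 := V.property.2 _ ((Submodule.ne_bot_iff _).2
      ⟨_, raise_mem_weightSpace hv α x hx a, h0⟩)
    rw [sub_add_cancel_left] at h1
    exact (rootSystem H).ne_zero α (eq_zero_of_posCone hα h1)
  induction hu using Submodule.span_induction with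
  | mem u hu =>
    cases hu with
    | raise α hα x hx a => exact hraise α hα x hx a
    | weight h => rw [sub_smul, hv h, sub_self]
    | lower i hi y hy n hn =>
      by_cases hy0 : y = 0
      · rw [hy0, cur_zero, zero_pow n.succ_ne_zero, zero_smul]
      obtain ⟨e, he, ht⟩ := exists_sl2 i y hy hy0
      refine lower_pow_smul_eq_zero V.property.1 ht n ?_
        (hraise i (AddSubmonoid.subset_closure ⟨i, hi, rfl⟩) e he 1)
      rw [hv, hn]
      rfl
  | zero => rw [zero_smul]
  | add u v _ _ hu hv => rw [add_smul, hu, hv, add_zero]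
  | smul r u _ hu => rw [smul_assoc, hu, smul_zero]

/-- `Ann(w_λ)` kills `V_λ` for every `V` in `I_A^λ`. -/
lemma isTorsionBySet_weightSpace (V : BoundedCat b A lam) :
    Module.IsTorsionBySet (CartanEnv H A) (weightSpace H A V.obj lam) (annW b A lam) := by
  rintro ⟨v, hv⟩ ⟨c, hc⟩
  refine Subtype.ext (weylIdeal_smul_eq_zero V ?_ hv)
  rw [← mul_one (c : Env 𝔤 A)]
  exact (Submodule.Quotient.mk_eq_zero _).1 hc

/-- The `𝐀_λ`-module structure on `V_λ` induced by the action of `U(𝔥 ⊗ A)`. -/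
instance (V : BoundedCat b A lam) : Module (ALam b A lam) (weightSpace H A V.obj lam) :=
  (isTorsionBySet_weightSpace V).module

/-- The object `𝐑_A^λ V`: the weight space `V_λ`, as an `𝐀_λ`-module. -/
def restrObj (V : BoundedCat b A lam) : ModuleCat.{u} (ALam b A lam) :=
  ModuleCat.of (ALam b A lam) (weightSpace H A V.obj lam)

end Restriction

end Weyl

section Vanishing

variable {𝔤 : Type u} [LieRing 𝔤] [LieAlgebra ℂ 𝔤] [FiniteDimensional ℂ 𝔤]
  [LieAlgebra.IsSimple ℂ 𝔤] {H : LieSubalgebra ℂ 𝔤} [H.IsCartanSubalgebra]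
  {b : (rootSystem H).Base} {A : Type u} [CommRing A] [Algebra ℂ A] {lam : Module.Dual ℂ H}

/-- `Hom(V, U) = 0` and `Ext¹(V, U) = 0` in `I_A^λ` for every `U` in `I_A^λ` with `U_λ = 0`. -/
def HomExtVanish (V : BoundedCat b A lam) : Prop :=
  ∀ U : BoundedCat b A lam, weightSpace H A U.obj lam = ⊥ →
    Subsingleton (V ⟶ U) ∧ Subsingleton (Abelian.Ext V U 1)

end Vanishing

end
end CurrentAlgebra

/-! The functor `𝐖` is left adjoint to `𝐑`, and the theorem follows from three facts about this
pair. First, `𝐖 M` lies in `I_A^λ` (`boundedIntegrable_weylObj`). Second, the unit `M → 𝐑 𝐖 M` is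
bijective (`wtSpace_weylObj`, `topVec_injective`). Third, `𝐑` is exact on `I_A^λ`, the nontrivial
point being surjectivity (`exists_mem_weightSpace_map_eq`).

Suppose `V ≅ 𝐖 M` and `U_λ = 0`. A map `V → U` kills the generators `w_λ ⊗ m`, so it is zero. In an
extension `0 → U → E → V → 0`, exactness gives `E_λ ≅ V_λ`; so `M → V_λ` lifts to `E_λ`, and the
adjoint map `𝐖 M → E` is a section (`exists_section_of_iso`).

Conversely, assume the vanishing and consider the counit `ε : 𝐖 𝐑 V → V`. Its image contains `V_λ`,
so its cokernel has no weight `λ` and vanishes by the Hom condition. Its kernel `K` satisfies `K_λ =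
0` by the second fact, so the Ext condition splits `ε`. The resulting retraction `𝐖 𝐑 V → K` is
zero, and `ε` is an isomorphism (`isIso_weylCounit`). The statement on simple modules follows from
`M ≅ 𝐑 𝐖 M`.

The first fact rests on the finite group generated by the simple reflections: it bounds the heights
`ht(λ - μ)` of the weights, so lowering operators eventually kill a highest weight vector. The third
is an `sl₂` computation excluding Jordan blocks of the simple coroots at weight `λ`. -/

section YonedaExt

/-! ### Vanishing of `Ext¹` and splitting of extensions -/

open CategoryTheory CategoryTheory.Limits DerivedCategory

namespace CategoryTheory.Abelian.Ext

universe w v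

variable {C : Type u} [Category.{v} C] [Abelian C]

/-- Since `K` vanishes above degree `i`, all of `K.X i` consists of cycles. The map is then the
projection onto homology followed by the isomorphism that `π` induces on `H^i`. -/
lemma epi_f_comp_singleObjXSelf_of_quasiIsoAt {X : C} {K : CochainComplex C ℤ} {i : ℤ}
    (π : K ⟶ (HomologicalComplex.single C (ComplexShape.up ℤ) i).obj X) [K.IsStrictlyLE i]
    [QuasiIsoAt π i] :
    Epi (π.f i ≫ (HomologicalComplex.singleObjXSelf (ComplexShape.up ℤ) i X).hom) := by
  let e := K.iCyclesIso i (i + 1) (by simp)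
    ((K.isZero_of_isStrictlyLE i (i + 1) (by simp)).eq_of_tgt _ _)
  have : π.f i ≫ (HomologicalComplex.singleObjXSelf (ComplexShape.up ℤ) i X).hom =
      e.inv ≫ K.homologyπ i ≫ HomologicalComplex.homologyMap π i ≫
        (HomologicalComplex.singleObjHomologySelfIso _ _ _).hom := by
    rw [← cancel_epi e.hom, e.hom_inv_id_assoc, HomologicalComplex.homologyπ_naturality_assoc,
      HomologicalComplex.homologyπ_singleObjHomologySelfIso_hom,
      ← cancel_mono (HomologicalComplex.singleObjXSelf (ComplexShape.up ℤ) i X).inv]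
    simp only [Category.assoc, Iso.hom_inv_id, Category.comp_id]
    rw [HomologicalComplex.singleObjCyclesSelfIso_hom, Category.assoc, Iso.hom_inv_id,
      Category.comp_id, HomologicalComplex.cyclesMap_i]
    rfl
  rw [this]
  infer_instance

variable [HasExt.{w} C]

/-- Every class of positive degree is killed by the pull-back along some epimorphism. -/
lemma exists_epi_mk₀_comp_eq_zero {X Y : C} {n : ℕ} (α : Ext X Y (n + 1)) :
    ∃ (P : C) (p : P ⟶ X), Epi p ∧ (mk₀ p).comp α (zero_add _) = 0 := by
  let := HasDerivedCategory.standard C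
  let φ : Q.obj ((CochainComplex.singleFunctor C 0).obj X) ⟶
      Q.obj ((CochainComplex.singleFunctor C (-(n + 1 : ℤ))).obj Y) :=
    α.hom ≫ ((singleFunctors C).shiftIso (n + 1) (-(n + 1)) 0 (by lia)).hom.app _
  -- The class becomes a roof `X ← K → Y` with `Y` in degree `-(n + 1)` and `K` in degrees at most
  -- `0`. The epimorphism sought is `K.X 0 → X`.
  obtain ⟨K, _, π, h, g, hg⟩ := right_fac_of_isStrictlyLE φ 0
  rw [isIso_Q_map_iff_quasiIso] at h
  let π' : K ⟶ (HomologicalComplex.single C (ComplexShape.up ℤ) 0).obj X := π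
  have : QuasiIsoAt π' 0 := h.quasiIsoAt 0
  refine ⟨K.X 0, _, epi_f_comp_singleObjXSelf_of_quasiIsoAt π', ?_⟩
  set p := π'.f 0 ≫ (HomologicalComplex.singleObjXSelf (ComplexShape.up ℤ) 0 X).hom with hp
  -- The degree-zero term includes into `K` as a chain map because `K.X 1` is zero. Pulling the
  -- class back along `p` amounts to `j ≫ g`, which vanishes because its target has nothing in
  -- degree `0`.
  let j : (HomologicalComplex.single C (ComplexShape.up ℤ) 0).obj (K.X 0) ⟶ K :=
    HomologicalComplex.mkHomFromSingle (𝟙 (K.X 0)) (by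
      rintro _ rfl
      exact (K.isZero_of_isStrictlyLE 0 (0 + 1) (by simp)).eq_of_tgt _ _)
  have hj : j ≫ π' = (HomologicalComplex.single C (ComplexShape.up ℤ) 0).map p := by
    apply HomologicalComplex.from_single_hom_ext
    rw [HomologicalComplex.single_map_f_self, hp, HomologicalComplex.comp_f,
      HomologicalComplex.mkHomFromSingle_f]
    simp
  have hjg : j ≫ g = 0 := by
    apply HomologicalComplex.from_single_hom_ext
    exact (((CochainComplex.singleFunctor C (-(n + 1 : ℤ))).obj Y).isZero_of_isStrictlyLE
      (-(n + 1)) 0 (by lia)).eq_of_tgt _ _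
  have key : Q.map (j ≫ π) ≫ φ = 0 := by
    rw [Q.map_comp, hg, Category.assoc, IsIso.hom_inv_id_assoc, ← Q.map_comp, hjg, Q.map_zero]
  have hj' : Q.map (j ≫ π) = (singleFunctor C 0).map p := congrArg Q.map hj
  apply homEquiv.injective
  change hom _ = hom _
  rw [zero_hom, comp_hom, mk₀_hom, ShiftedHom.mk₀_comp,
    ← cancel_mono (((singleFunctors C).shiftIso (n + 1) (-(n + 1)) 0 (by lia)).hom.app _),
    Category.assoc, Limits.zero_comp]
  exact (congrArg (· ≫ φ) hj').symm.trans key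

/-- By the covariant long exact sequence, the identity of `S.X₃` lifts to `S.X₂` once its image in
`Ext¹` is zero. -/
lemma exists_section_of_subsingleton {S : ShortComplex C} (hS : S.ShortExact)
    (h : Subsingleton (Ext S.X₃ S.X₁ 1)) : ∃ s : S.X₃ ⟶ S.X₂, s ≫ S.g = 𝟙 _ := by
  obtain ⟨x, hx⟩ := covariant_sequence_exact₃ S.X₃ hS (mk₀ (𝟙 S.X₃)) (zero_add 1)
    (Subsingleton.elim _ _)
  obtain ⟨s, rfl⟩ := addEquiv₀.symm.surjective x
  refine ⟨s, addEquiv₀.symm.injective ?_⟩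
  simpa using hx

/-- A class `α` dies on some epimorphism `p : P ⟶ V`, so it is the connecting image of some `β : ker
p ⟶ U`. The pushout of `P` along `β` is an extension of `V` by `U`; a splitting extends `β` to `P`,
and connecting images of maps that extend to `P` are zero. -/
lemma subsingleton_of_forall_exists_section (V U : C)
    (h : ∀ (E : C) (f : U ⟶ E) (g : E ⟶ V) (w : f ≫ g = 0),
      (ShortComplex.mk f g w).ShortExact → ∃ s : V ⟶ E, s ≫ g = 𝟙 V) :
    Subsingleton (Ext V U 1) := by
  refine subsingleton_of_forall_eq 0 fun α ↦ ?_
  obtain ⟨P, p, hp, hα⟩ := exists_epi_mk₀_comp_eq_zero (n := 0) α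
  let S := ShortComplex.mk _ _ (kernel.condition p)
  have hS : S.ShortExact := { exact := ShortComplex.exact_of_f_is_kernel _ (kernelIsKernel p) }
  obtain ⟨x, rfl⟩ := contravariant_sequence_exact₃ hS U α hα (add_zero 1)
  obtain ⟨β, rfl⟩ := addEquiv₀.symm.surjective x
  let g : pushout S.f β ⟶ V := pushout.desc p 0 (by simp [S])
  have hg : pushout.inl S.f β ≫ g = p := pushout.inl_desc _ _ _
  have w : pushout.inr S.f β ≫ g = 0 := pushout.inr_desc _ _ _
  have : Epi g := epi_of_epi_fac hg
  have hc : IsColimit (CokernelCofork.ofπ g w) :=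
    CokernelCofork.IsColimit.ofπ' _ _ fun {T} φ hφ ↦
      ⟨hS.exact.desc (pushout.inl S.f β ≫ φ) (by
          rw [pushout.condition_assoc, hφ, Limits.comp_zero]), by
        apply pushout.hom_ext
        · rw [reassoc_of% hg]
          exact hS.exact.g_desc _ _
        · exact (Category.assoc _ _ _).symm.trans
            ((congrArg (· ≫ _) w).trans (Limits.zero_comp.trans hφ.symm))⟩
  have hT : (ShortComplex.mk _ _ w).ShortExact :=
    { exact := ShortComplex.exact_of_g_is_cokernel _ hc }
  obtain ⟨s, hs⟩ := h _ _ _ _ hT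
  let σ := ShortComplex.Splitting.ofExactOfSection _ hT.exact s hs inferInstance
  have hr : pushout.inr S.f β ≫ σ.r = 𝟙 U := σ.f_r
  have hβ : β = S.f ≫ pushout.inl S.f β ≫ σ.r := by
    rw [pushout.condition_assoc, hr, Category.comp_id]
  have : addEquiv₀.symm β = (mk₀ S.f).comp (mk₀ (pushout.inl S.f β ≫ σ.r)) (zero_add 0) := by
    rw [mk₀_comp_mk₀, ← hβ]
    rfl
  rw [this]
  exact hS.extClass_comp_assoc _

end CategoryTheory.Abelian.Ext

end YonedaExt

namespace CurrentAlgebra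
noncomputable section

attribute [local instance] LieRing.ofAssociativeRing

open scoped ModuleCat
open LieModule (genWeightSpace)

/-! ### Passing from generators to the whole module -/

section Currents

variable {𝔤 A : Type u} [LieRing 𝔤] [LieAlgebra ℂ 𝔤] [CommRing A] [Algebra ℂ A]
  {V : ModuleCat.{u} (Env 𝔤 A)}

lemma cur_neg (x : 𝔤) (a : A) : cur (-x) a = -cur x a := by
  simp only [cur, TensorProduct.tmul_neg, map_neg]

/-- A subspace stable under all `x ⊗ a` is stable under `U(𝔤 ⊗ A)`. -/
lemma env_smul_mem {N : Submodule ℂ V}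
    (hN : ∀ (x : 𝔤) (a : A), ∀ m ∈ N, (cur x a : Env 𝔤 A) • m ∈ N) (u : Env 𝔤 A) {m : V}
    (hm : m ∈ N) : u • m ∈ N := by
  let T : Subalgebra ℂ (Env 𝔤 A) :=
    { carrier := {u | ∀ m ∈ N, u • m ∈ N}
      mul_mem' := fun {u v} hu hv m hm ↦ by rw [mul_smul]; exact hu _ (hv _ hm)
      add_mem' := fun {u v} hu hv m hm ↦ by rw [add_smul]; exact add_mem (hu _ hm) (hv _ hm)
      algebraMap_mem' := fun c m hm ↦ by rw [algebraMap_smul]; exact N.smul_mem c hm }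
  have hι : ∀ z : A ⊗[ℂ] 𝔤, UniversalEnvelopingAlgebra.ι ℂ z ∈ T := by
    intro z
    induction z using TensorProduct.induction_on with
    | zero => rw [map_zero]; exact zero_mem _
    | tmul a x => exact fun m hm ↦ hN x a m hm
    | add z w hz hw => rw [map_add]; exact add_mem hz hw
  let φ : A ⊗[ℂ] 𝔤 →ₗ⁅ℂ⁆ T :=
    { toFun z := ⟨_, hι z⟩
      map_add' z w := Subtype.ext (map_add _ z w)
      map_smul' c z := Subtype.ext (map_smul _ c z)
      map_lie' {z w} := Subtype.ext (LieHom.map_lie _ z w) }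
  -- By the universal property the composite `U(𝔤 ⊗ A) → T → U(𝔤 ⊗ A)` is the identity, so `T` is
  -- everything.
  have h : T.val.comp (UniversalEnvelopingAlgebra.lift ℂ φ) = AlgHom.id ℂ _ := by
    ext z
    simp [φ]
  have hu : ((UniversalEnvelopingAlgebra.lift ℂ φ u : T) : Env 𝔤 A) = u :=
    DFunLike.congr_fun h u
  exact hu ▸ (UniversalEnvelopingAlgebra.lift ℂ φ u).2 m hm

/-- If `ad x` is nilpotent then `x ⊗ 1` acts locally nilpotently as soon as it does so on
generators. -/
lemma exists_cur_pow_smul_eq_zero {x : 𝔤} (hx : IsNilpotent (ad ℂ 𝔤 x)) {S : Set V}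
    (hS : ∀ s ∈ S, ∃ n : ℕ, (cur x 1 ^ n : Env 𝔤 A) • s = 0)
    (hgen : Submodule.span (Env 𝔤 A) S = ⊤) (v : V) :
    ∃ n : ℕ, (cur x 1 ^ n : Env 𝔤 A) • v = 0 := by
  let N : Submodule ℂ V :=
    { carrier := {v | ∃ n : ℕ, (cur x 1 ^ n : Env 𝔤 A) • v = 0}
      add_mem' := by
        rintro v w ⟨m, hm⟩ ⟨n, hn⟩
        refine ⟨m + n, ?_⟩
        rw [smul_add, pow_add, mul_smul _ _ w, hn, ← pow_add, add_comm m, pow_add, mul_smul, hm]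
        simp
      zero_mem' := ⟨0, smul_zero _⟩
      smul_mem' := by
        rintro c v ⟨n, hn⟩
        exact ⟨n, by rw [smul_comm, hn, smul_zero]⟩ }
  -- In `x (y v) = y (x v) + [x, y] v` the first term lowers `n` by one and the second lowers `N` by
  -- one, so the induction runs on a bound for `N + n`.
  have key : ∀ k N n : ℕ, N + n ≤ k → ∀ (y : 𝔤) (a : A) (v : V), (ad ℂ 𝔤 x ^ N) y = 0 →
      (cur x 1 ^ n : Env 𝔤 A) • v = 0 → (cur x 1 ^ k : Env 𝔤 A) • (cur y a : Env 𝔤 A) • v = 0 := by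
    intro k
    induction k with
    | zero =>
      intro N n hk y a v hy hv
      obtain rfl : N = 0 := by omega
      have hy' : y = 0 := hy
      rw [hy', cur_zero, zero_smul, smul_zero]
    | succ k ih =>
      intro N n hk y a v hy hv
      rcases N with _ | N
      · have hy' : y = 0 := hy
        rw [hy', cur_zero, zero_smul, smul_zero]
      rcases n with _ | n
      · have hv' : v = 0 := by simpa using hv
        rw [hv', smul_zero, smul_zero]
      rw [pow_succ, mul_smul, ← mul_smul _ _ v, cur_mul_cur, add_smul, mul_smul, smul_add, one_mul,
        ih (N + 1) n (by omega) y a _ hy (by rw [← mul_smul, ← pow_succ, hv]),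
        ih N (n + 1) (by omega) ⁅x, y⁆ a v (by rw [← hy, pow_succ]; rfl) hv, add_zero]
  obtain ⟨M, hM⟩ := hx
  have hN : ∀ (y : 𝔤) (a : A), ∀ m ∈ N, (cur y a : Env 𝔤 A) • m ∈ N := by
    rintro y a v ⟨n, hn⟩
    exact ⟨M + n, key _ M n le_rfl y a v (by rw [hM]; rfl) hn⟩
  let N' : Submodule (Env 𝔤 A) V := { N with smul_mem' := fun u _ h ↦ env_smul_mem hN u h }
  have : N' = ⊤ := by
    rw [eq_top_iff, ← hgen, Submodule.span_le]
    exact hS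
  have hv : v ∈ N' := this ▸ Submodule.mem_top
  exact hv

/-- A module generated by vectors that lie in finite-dimensional `𝔤`-stable subspaces is
integrable. -/
lemma IsIntegrable.of_span_eq_top [FiniteDimensional ℂ 𝔤] {S : Set V}
    (hS : ∀ s ∈ S, ∃ F : Submodule ℂ V, FiniteDimensional ℂ F ∧
      (∀ (x : 𝔤), ∀ m ∈ F, (cur x 1 : Env 𝔤 A) • m ∈ F) ∧ s ∈ F)
    (hgen : Submodule.span (Env 𝔤 A) S = ⊤) : IsIntegrable V := by
  let N : Submodule ℂ V :=
    { carrier := {v | ∃ F : Submodule ℂ V, FiniteDimensional ℂ F ∧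
        (∀ (x : 𝔤), ∀ m ∈ F, (cur x 1 : Env 𝔤 A) • m ∈ F) ∧ v ∈ F}
      add_mem' := by
        rintro v w ⟨F, h1, h2, h3⟩ ⟨G, k1, k2, k3⟩
        refine ⟨F ⊔ G, inferInstance, fun x m hm ↦ ?_,
          add_mem (Submodule.mem_sup_left h3) (Submodule.mem_sup_right k3)⟩
        obtain ⟨y, hy, z, hz, rfl⟩ := Submodule.mem_sup.1 hm
        rw [smul_add]
        exact add_mem (Submodule.mem_sup_left (h2 x y hy)) (Submodule.mem_sup_right (k2 x z hz))
      zero_mem' := ⟨⊥, inferInstance, by simp, zero_mem _⟩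
      smul_mem' := by
        rintro c v ⟨F, h1, h2, h3⟩
        exact ⟨F, h1, h2, F.smul_mem c h3⟩ }
  have hN : ∀ (y : 𝔤) (a : A), ∀ m ∈ N, (cur y a : Env 𝔤 A) • m ∈ N := by
    rintro y a v ⟨F, h1, h2, h3⟩
    let β : 𝔤 →ₗ[ℂ] V →ₗ[ℂ] V := LinearMap.mk₂ ℂ (fun x m ↦ (cur x a : Env 𝔤 A) • m)
      (fun x y m ↦ by rw [cur_add, add_smul]) (fun c x m ↦ by rw [cur_smul, smul_assoc])
      (fun x m n ↦ smul_add _ _ _) (fun c x m ↦ smul_comm _ _ _)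
    -- The witness is `(𝔤 ⊗ a) F`. It is finite-dimensional because `𝔤` and `F` are, and stable
    -- because `x (z ⊗ a) n = (z ⊗ a) x n + ([x, z] ⊗ a) n`.
    refine ⟨Submodule.map₂ β ⊤ F, ?_, fun x m hm ↦ ?_, Submodule.apply_mem_map₂ β trivial h3⟩
    · exact Module.Finite.of_fg
        (Submodule.FG.map₂ β (Module.Finite.fg_top) (Module.Finite.iff_fg.1 h1))
    · rw [Submodule.map₂_eq_span_image2] at hm
      induction hm using Submodule.span_induction with
      | mem m hm =>
        obtain ⟨z, -, n, hn, rfl⟩ := hm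
        change (cur x 1 : Env 𝔤 A) • (cur z a : Env 𝔤 A) • n ∈ _
        rw [← mul_smul, cur_mul_cur, add_smul, mul_smul, one_mul]
        exact add_mem (Submodule.apply_mem_map₂ β trivial (h2 x n hn))
          (Submodule.apply_mem_map₂ β trivial hn)
      | zero => rw [smul_zero]; exact zero_mem _
      | add _ _ _ _ h h' => rw [smul_add]; exact add_mem h h'
      | smul c _ _ h => rw [smul_comm]; exact Submodule.smul_mem _ c h
  let N' : Submodule (Env 𝔤 A) V := { N with smul_mem' := fun u _ h ↦ env_smul_mem hN u h }
  have : N' = ⊤ := by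
    rw [eq_top_iff, ← hgen, Submodule.span_le]
    exact hS
  intro v
  have hv : v ∈ N' := this ▸ Submodule.mem_top
  exact hv

end Currents

/-! ### Weight spaces and the root decomposition -/

section Weights

variable {𝔤 : Type u} [LieRing 𝔤] [LieAlgebra ℂ 𝔤] [FiniteDimensional ℂ 𝔤]
  [LieAlgebra.IsSimple ℂ 𝔤] {H : LieSubalgebra ℂ 𝔤} [H.IsCartanSubalgebra]

/-- The root spaces and `H`, which is the zero root space, span `𝔤`, and each root is positive or
negative with respect to the base. -/
lemma root_induction (b : (rootSystem H).Base) {p : 𝔤 → Prop}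
    (add : ∀ x y, p x → p y → p (x + y)) (cartan : ∀ h : H, p h)
    (pos : ∀ α : H.root, (rootSystem H).root α ∈ posCone b → ∀ x ∈ rootSpace H α.1, p x)
    (neg : ∀ α : H.root, -(rootSystem H).root α ∈ posCone b → ∀ x ∈ rootSpace H α.1, p x)
    (x : 𝔤) : p x := by
  have hx : x ∈ ⨆ χ : LieModule.Weight ℂ H 𝔤, genWeightSpace 𝔤 χ := by
    rw [LieModule.iSup_genWeightSpace_eq_top']; trivial
  refine LieSubmodule.iSup_induction _ (motive := p) hx (fun χ y hy ↦ ?_) (cartan 0) add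
  by_cases hχ : χ.IsZero
  · rw [hχ.eq] at hy
    have : y ∈ H := by
      rw [← LieAlgebra.zeroRootSubalgebra_eq_of_is_cartan ℂ 𝔤 H]
      exact hy
    exact cartan ⟨y, this⟩
  · let α : H.root := ⟨χ, by simpa [LieSubalgebra.root] using hχ⟩
    exact (b.root_mem_or_neg_mem α).elim (fun h ↦ pos α h y hy) (fun h ↦ neg α h y hy)

variable {A : Type u} [CommRing A] [Algebra ℂ A] (V : ModuleCat.{u} (Env 𝔤 A))

variable (H) in
/-- The weight space `V_μ` as a complex subspace. -/
def wtSpace (μ : Module.Dual ℂ H) : Submodule ℂ V where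
  carrier := weightSpace H A V μ
  add_mem' := add_mem
  zero_mem' := zero_mem _
  smul_mem' c v hv h := by
    rw [smul_comm, hv h, smul_comm]

variable {V}

lemma mem_wtSpace {μ : Module.Dual ℂ H} {v : V} :
    v ∈ wtSpace H V μ ↔ ∀ h : H, (cur (h : 𝔤) 1 : Env 𝔤 A) • v = μ h • v := by
  simp_rw [← algebraMap_smul (Env 𝔤 A) (_ : ℂ) v]
  rfl

lemma mem_wtSpace' {μ : Module.Dual ℂ H} {v : V} :
    v ∈ wtSpace H V μ ↔ v ∈ weightSpace H A V μ := Iff.rfl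

lemma cur_mem_wtSpace {μ χ : Module.Dual ℂ H} {v : V} (hv : v ∈ wtSpace H V μ) {x : 𝔤}
    (hx : x ∈ rootSpace H χ) (a : A) : (cur x a : Env 𝔤 A) • v ∈ wtSpace H V (μ + χ) := by
  rw [mem_wtSpace] at *
  intro h
  have hb : ⁅(h : 𝔤), x⁆ = χ h • x := lie_eq_smul_of_mem_rootSpace hx h
  rw [← mul_smul, cur_mul_cur, hb, cur_smul, one_mul, add_smul,
    mul_smul, hv h, smul_comm, smul_assoc, LinearMap.add_apply, add_smul]

lemma cur_pow_mem_wtSpace {μ χ : Module.Dual ℂ H} {v : V} (hv : v ∈ wtSpace H V μ) {x : 𝔤}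
    (hx : x ∈ rootSpace H χ) (a : A) (n : ℕ) :
    (cur x a ^ n : Env 𝔤 A) • v ∈ wtSpace H V (μ + n • χ) := by
  induction n with
  | zero => simpa using hv
  | succ n ih =>
    rw [pow_succ', mul_smul, succ_nsmul, ← add_assoc]
    exact cur_mem_wtSpace ih hx a

lemma iSupIndep_wtSpace : iSupIndep (wtSpace H V) := by
  let i1 := lieRingModule (𝔤 := 𝔤) (A := A) V
  have i2 := lieModule (𝔤 := 𝔤) (A := A) V
  have h := (LieSubmodule.iSupIndep_toSubmodule.2 (LieModule.iSupIndep_genWeightSpace ℂ H V)).comp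
    (f := fun μ : Module.Dual ℂ H ↦ (μ : H → ℂ)) DFunLike.coe_injective
  refine h.mono fun μ v hv ↦ LieModule.weightSpace_le_genWeightSpace V _ ?_
  rw [LieModule.mem_weightSpace]
  exact mem_wtSpace.1 hv

end Weights

/-! ### Weight strings for `sl₂` -/

section Sl2

variable {𝔤 A : Type u} [LieRing 𝔤] [LieAlgebra ℂ 𝔤] [CommRing A] [Algebra ℂ A]
  {V : ModuleCat.{u} (Env 𝔤 A)}

/-- Let `e ^ k v` be the last nonzero vector obtained by raising `v`. It is primitive of weight `c +
2 k`, and local nilpotency of `f` forces this weight to be a natural number `N`. The vector `f ^ (N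
- k) e ^ k v` then has weight `-c`, which is what reflects a weight. The hypothesis `k ≤ N` keeps
the natural subtraction honest. -/
lemma exists_weight_string {h e f : 𝔤} (ht : IsSl2Triple h e f) {c : ℂ} {v : V} (hv0 : v ≠ 0)
    (hv : (cur h 1 : Env 𝔤 A) • v = c • v) (he : ∃ n : ℕ, (cur e 1 ^ n : Env 𝔤 A) • v = 0)
    (hf : ∀ w : V, ∃ n : ℕ, (cur f 1 ^ n : Env 𝔤 A) • w = 0) :
    ∃ k N : ℕ, c = N - 2 * k ∧
      (k ≤ N → (cur f 1 ^ (N - k) : Env 𝔤 A) • (cur e 1 ^ k : Env 𝔤 A) • v ≠ 0) := by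
  let i1 := lieRingModule (𝔤 := 𝔤) (A := A) V
  have i2 := lieModule (𝔤 := 𝔤) (A := A) V
  have hpow : ∀ (x : 𝔤) (n : ℕ) (w : V),
      (LieModule.toEnd ℂ 𝔤 V x ^ n) w = (cur x 1 ^ n : Env 𝔤 A) • w := by
    intro x n w
    induction n with
    | zero => simp
    | succ n ih =>
      rw [pow_succ', pow_succ', mul_smul, ← ih]
      rfl
  obtain ⟨k, hk, hk'⟩ := Nat.exists_not_and_succ_of_not_zero_of_exists
    (p := fun n ↦ (cur e 1 ^ n : Env 𝔤 A) • v = 0) (by simpa using hv0) he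
  have P : ht.HasPrimitiveVectorWith ((cur e 1 ^ k : Env 𝔤 A) • v) (c + 2 * k) :=
    { ne_zero := hk
      lie_h := by
        rw [← hpow]
        exact IsSl2Triple.lie_h_pow_toEnd_e ht (m := v) hv k
      lie_e := by
        change (cur e 1 : Env 𝔤 A) • (cur e 1 ^ k : Env 𝔤 A) • v = 0
        rw [← mul_smul, ← pow_succ']
        exact hk' }
  obtain ⟨N, hN, hN'⟩ := Nat.exists_not_and_succ_of_not_zero_of_exists
    (p := fun n ↦ (cur f 1 ^ n : Env 𝔤 A) • (cur e 1 ^ k : Env 𝔤 A) • v = 0)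
    (by simpa using hk) (hf _)
  have hc : c + 2 * k = N := by
    have := P.lie_e_pow_succ_toEnd_f N
    rw [hpow, hpow, hN', lie_zero, eq_comm, smul_eq_zero_iff_left hN, mul_eq_zero,
      sub_eq_zero] at this
    exact this.resolve_left (Nat.cast_add_one_ne_zero N)
  refine ⟨k, N, by rw [← hc]; ring, fun hkN ↦ ?_⟩
  rw [← hpow]
  exact P.pow_toEnd_f_ne_zero_of_eq_nat hc (Nat.sub_le N k)

end Sl2

/-! ### Heights and the finite reflection group -/

section Height

variable {𝔤 : Type u} [LieRing 𝔤] [LieAlgebra ℂ 𝔤] [FiniteDimensional ℂ 𝔤]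
  [LieAlgebra.IsSimple ℂ 𝔤] {H : LieSubalgebra ℂ 𝔤} [H.IsCartanSubalgebra]

/-- The height functional, equal to one on simple roots. -/
lemma exists_height (b : (rootSystem H).Base) : ∃ φ : Module.Dual ℂ H →ₗ[ℂ] ℂ,
    ∀ x ∈ posCone b, ∃ n : ℕ, φ x = n ∧ (n = 0 → x = 0) := by
  have hli : LinearIndependent ℂ (fun i : b.support ↦ (rootSystem H).root i) :=
    b.linearIndepOn_root
  obtain ⟨φ, hφ⟩ := LinearMap.exists_extend
    ((Module.Basis.span hli).constr ℂ (fun _ : b.support ↦ (1 : ℂ)))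
  have hφ1 : ∀ i : b.support, φ ((rootSystem H).root i) = 1 := by
    intro i
    have h := LinearMap.congr_fun hφ (Module.Basis.span hli i)
    rw [Module.Basis.constr_basis] at h
    rw [← h, LinearMap.comp_apply, Submodule.subtype_apply, Module.Basis.span_apply]
  refine ⟨φ, fun x hx ↦ ?_⟩
  induction hx using AddSubmonoid.closure_induction with
  | mem x hx =>
    obtain ⟨i, hi, rfl⟩ := hx
    exact ⟨1, by simpa using hφ1 ⟨i, hi⟩, by simp⟩
  | zero => exact ⟨0, by simp, by simp⟩
  | add x y _ _ hx hy =>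
    obtain ⟨m, h1, h2⟩ := hx
    obtain ⟨n, h3, h4⟩ := hy
    refine ⟨m + n, by simp [h1, h3], fun h ↦ ?_⟩
    rw [h2 (by omega), h4 (by omega), add_zero]

/-- The group generated by the simple reflections. -/
def simpleReflectionGroup (b : (rootSystem H).Base) :
    Subgroup (Module.Dual ℂ H ≃ₗ[ℂ] Module.Dual ℂ H) :=
  Subgroup.closure ((rootSystem H).reflection '' b.support)

lemma reflection_mem_simpleReflectionGroup {b : (rootSystem H).Base} {i : H.root}
    (hi : i ∈ b.support) : (rootSystem H).reflection i ∈ simpleReflectionGroup b :=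
  Subgroup.subset_closure ⟨i, hi, rfl⟩

lemma simpleReflectionGroup_apply_mem {b : (rootSystem H).Base} {Ω : Set (Module.Dual ℂ H)}
    (hΩ : ∀ μ ∈ Ω, ∀ i ∈ b.support, (rootSystem H).reflection i μ ∈ Ω)
    {g : Module.Dual ℂ H ≃ₗ[ℂ] Module.Dual ℂ H} (hg : g ∈ simpleReflectionGroup b) :
    ∀ μ ∈ Ω, g μ ∈ Ω := by
  induction hg using Subgroup.closure_induction'' with
  | one => exact fun μ hμ ↦ hμ
  | mem g hg =>
    obtain ⟨i, hi, rfl⟩ := hg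
    exact fun μ hμ ↦ hΩ μ hμ i hi
  | inv_mem g hg =>
    obtain ⟨i, hi, rfl⟩ := hg
    rw [RootPairing.reflection_inv]
    exact fun μ hμ ↦ hΩ μ hμ i hi
  | mul g g' _ _ h h' => exact fun μ hμ ↦ h _ (h' μ hμ)

/-- The group permutes the finitely many roots, and an element is determined by this permutation
because the roots span. -/
instance (b : (rootSystem H).Base) : Finite (simpleReflectionGroup b) := by
  have hmem : ∀ (g : simpleReflectionGroup b) (i : H.root),
      (g : Module.Dual ℂ H ≃ₗ[ℂ] Module.Dual ℂ H) ((rootSystem H).root i) ∈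
        Set.range (rootSystem H).root := fun g i ↦
    simpleReflectionGroup_apply_mem (by
      rintro _ ⟨j, rfl⟩ i -
      exact ⟨(rootSystem H).reflectionPerm i j, (rootSystem H).root_reflectionPerm i j⟩) g.2 _ ⟨i, rfl⟩
  refine Finite.of_injective
    (β := H.root → Set.range (rootSystem H).root) (fun g i ↦ ⟨_, hmem g i⟩) fun g g' h ↦ ?_
  refine Subtype.ext (LinearEquiv.toLinearMap_injective ?_)
  refine LinearMap.ext_on_range (v := (rootSystem H).root)
    (RootPairing.IsRootSystem.span_root_eq_top (P := rootSystem H)) fun i ↦ ?_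
  exact congrArg Subtype.val (congrFun h i)

/-- The heights `ht(λ - μ)` are bounded on a set of weights `μ ∈ λ - Q⁺` that is stable under the
simple reflections. -/
lemma exists_height_bound (b : (rootSystem H).Base) {φ : Module.Dual ℂ H →ₗ[ℂ] ℂ}
    (hφ : ∀ x ∈ posCone b, ∃ n : ℕ, φ x = n ∧ (n = 0 → x = 0)) (lam : Module.Dual ℂ H)
    {Ω : Set (Module.Dual ℂ H)} (hΩ : ∀ μ ∈ Ω, ∀ i ∈ b.support, (rootSystem H).reflection i μ ∈ Ω)
    (hΩ' : ∀ μ ∈ Ω, lam - μ ∈ posCone b) :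
    ∃ K : ℕ, ∀ μ ∈ Ω, ∀ n : ℕ, φ (lam - μ) = n → n ≤ K := by
  have := Fintype.ofFinite (simpleReflectionGroup b)
  -- The sum of `g μ` over the group is zero, so the heights of all `λ - g μ` add up to the group
  -- order times `φ lam`, independently of `μ`. Each is a natural number, hence at most this total.
  -- The real part and ceiling only turn a complex number into a natural one.
  refine ⟨⌈((Fintype.card (simpleReflectionGroup b) : ℂ) * φ lam).re⌉₊, fun μ hμ n hn ↦ ?_⟩
  have hsum : ∑ g : simpleReflectionGroup b, g.1 μ = 0 := by
    set σ := ∑ g : simpleReflectionGroup b, g.1 μ with hσ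
    -- A vector fixed by every simple reflection vanishes on the simple coroots, which span `H`.
    have hfix : ∀ i ∈ b.support, (rootSystem H).reflection i σ = σ := by
      intro i hi
      rw [hσ, map_sum]
      exact Fintype.sum_equiv
        (Equiv.mulLeft (⟨_, reflection_mem_simpleReflectionGroup hi⟩ : simpleReflectionGroup b))
        _ _ fun g ↦ rfl
    have h0 : ∀ i ∈ b.support, σ ((rootSystem H).coroot i) = 0 := by
      intro i hi
      have h1 := hfix i hi
      rw [RootPairing.reflection_apply, sub_eq_self, smul_eq_zero] at h1
      exact h1.resolve_right ((rootSystem H).ne_zero i)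
    have hspan : Submodule.span ℂ ((rootSystem H).coroot '' b.support) = ⊤ := by
      rw [RootPairing.Base.span_coroot_support]
      exact RootPairing.IsRootSystem.span_coroot_eq_top
    refine LinearMap.ext_on hspan ?_
    rintro _ ⟨i, hi, rfl⟩
    exact h0 i hi
  have hmem : ∀ g : simpleReflectionGroup b, lam - g.1 μ ∈ posCone b := fun g ↦
    hΩ' _ (simpleReflectionGroup_apply_mem hΩ g.2 μ hμ)
  choose N hN _ using fun g ↦ hφ _ (hmem g)
  have htot : ((∑ g, N g : ℕ) : ℂ) = Fintype.card (simpleReflectionGroup b) * φ lam := by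
    rw [Nat.cast_sum, ← Finset.sum_congr rfl (fun g _ ↦ hN g), ← map_sum, Finset.sum_sub_distrib,
      hsum, sub_zero, Finset.sum_const, map_nsmul, nsmul_eq_mul, Finset.card_univ]
  have h1 : N 1 = n := by
    have := hN 1
    rw [Subgroup.coe_one] at this
    exact_mod_cast this.symm.trans hn
  rw [← htot, Complex.natCast_re, Nat.ceil_natCast, ← h1]
  exact Finset.single_le_sum (fun _ _ ↦ Nat.zero_le _) (Finset.mem_univ 1)

end Height

/-! ### Modules generated by highest weight vectors -/

section HighestWeight

variable {𝔤 : Type u} [LieRing 𝔤] [LieAlgebra ℂ 𝔤] [FiniteDimensional ℂ 𝔤]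
  [LieAlgebra.IsSimple ℂ 𝔤] {H : LieSubalgebra ℂ 𝔤} [H.IsCartanSubalgebra]
  (b : (rootSystem H).Base) {A : Type u} [CommRing A] [Algebra ℂ A] {V : ModuleCat.{u} (Env 𝔤 A)}

/-- A subspace is stable under the `x ⊗ a` with `x` in a negative root space and `a ∈ B`. -/
def LowerStable (B : Submonoid A) (T : Submodule ℂ V) : Prop :=
  ∀ α : H.root, -(rootSystem H).root α ∈ posCone b → ∀ x ∈ rootSpace H α.1, ∀ a ∈ B, ∀ m ∈ T,
    (cur x a : Env 𝔤 A) • m ∈ T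

/-- The smallest lower stable subspace containing `S`. -/
def lowerClosure (B : Submonoid A) (S : Submodule ℂ V) : Submodule ℂ V :=
  sInf {T | S ≤ T ∧ LowerStable b B T}

variable {b}

lemma le_lowerClosure (B : Submonoid A) (S : Submodule ℂ V) : S ≤ lowerClosure b B S :=
  le_sInf fun _ hT ↦ hT.1

lemma lowerClosure_le {B : Submonoid A} {S T : Submodule ℂ V} (h : S ≤ T)
    (hT : LowerStable b B T) : lowerClosure b B S ≤ T :=
  sInf_le ⟨h, hT⟩

lemma lowerStable_lowerClosure (B : Submonoid A) (S : Submodule ℂ V) :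
    LowerStable b B (lowerClosure b B S) := by
  intro α hα x hx a ha m hm
  rw [lowerClosure, Submodule.mem_sInf] at *
  exact fun T hT ↦ hT.2 α hα x hx a ha m (hm T hT)

/-- The lower closure of a space of highest weight vectors is stable under all of `𝔤 ⊗ B`. -/
lemma cur_mem_lowerClosure {B : Submonoid A} {S : Submodule ℂ V}
    (hcartan : ∀ h : H, ∀ a ∈ B, ∀ s ∈ S, (cur (h : 𝔤) a : Env 𝔤 A) • s ∈ S)
    (hraise : ∀ α : H.root, (rootSystem H).root α ∈ posCone b → ∀ x ∈ rootSpace H α.1, ∀ a ∈ B,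
      ∀ s ∈ S, (cur x a : Env 𝔤 A) • s = 0) (x : 𝔤) {a : A} (ha : a ∈ B) {m : V}
    (hm : m ∈ lowerClosure b B S) : (cur x a : Env 𝔤 A) • m ∈ lowerClosure b B S := by
  let N := lowerClosure b B S
  -- In place of a triangular decomposition of the enveloping algebra, `N'` is shown to contain `S`
  -- and to be lower stable. Commuting `x ⊗ a` past `y ⊗ c` leaves `[x, y] ⊗ a c`, so `B` has to be
  -- closed under products. The uses are `B = ⊤`, for `𝔤 ⊗ A`, and `B = ⊥`, for `𝔤` itself.
  let N' : Submodule ℂ V :=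
    { carrier := {d | d ∈ N ∧ ∀ (x : 𝔤), ∀ a ∈ B, (cur x a : Env 𝔤 A) • d ∈ N}
      add_mem' := fun hv hw ↦ ⟨add_mem hv.1 hw.1, fun x a ha ↦ by
        rw [smul_add]; exact add_mem (hv.2 x a ha) (hw.2 x a ha)⟩
      zero_mem' := ⟨zero_mem _, fun x a _ ↦ by rw [smul_zero]; exact zero_mem _⟩
      smul_mem' := fun c v hv ↦ ⟨N.smul_mem c hv.1, fun x a ha ↦ by
        rw [smul_comm]; exact N.smul_mem c (hv.2 x a ha)⟩ }
  have hle : N ≤ N' := by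
    refine lowerClosure_le (fun s hs ↦ ⟨le_lowerClosure B S hs, fun x a ha ↦ ?_⟩) ?_
    · induction x using root_induction b with
      | add x y hx hy => rw [cur_add, add_smul]; exact add_mem hx hy
      | cartan h => exact le_lowerClosure B S (hcartan h a ha s hs)
      | pos α hα x hx => rw [hraise α hα x hx a ha s hs]; exact zero_mem _
      | neg α hα x hx =>
        exact lowerStable_lowerClosure B S α hα x hx a ha s (le_lowerClosure B S hs)
    · intro α hα y hy c hc d hd
      refine ⟨lowerStable_lowerClosure B S α hα y hy c hc d hd.1, fun x a ha ↦ ?_⟩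
      rw [← mul_smul, cur_mul_cur, add_smul, mul_smul]
      exact add_mem (lowerStable_lowerClosure B S α hα y hy c hc _ (hd.2 x a ha))
        (hd.2 _ _ (mul_mem ha hc))
  exact (hle hm).2 x a ha

section Generated

variable {lam : Module.Dual ℂ H} {S : Submodule ℂ V}

/-- The module is the lower closure of `S`, so it suffices that the right-hand side is lower stable.
A lowering operator sends `S` and every strictly lower weight space into strictly lower weight
spaces. -/
lemma top_le_sup_iSup_wtSpace (hS : S ≤ wtSpace H V lam)
    (hcartan : ∀ (h : H) (a : A), ∀ s ∈ S, (cur (h : 𝔤) a : Env 𝔤 A) • s ∈ S)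
    (hraise : ∀ α : H.root, (rootSystem H).root α ∈ posCone b → ∀ x ∈ rootSpace H α.1, ∀ a : A,
      ∀ s ∈ S, (cur x a : Env 𝔤 A) • s = 0)
    (hgen : Submodule.span (Env 𝔤 A) (S : Set V) = ⊤) (v : V) :
    v ∈ S ⊔ ⨆ μ : {μ // lam - μ ∈ posCone b ∧ μ ≠ lam}, wtSpace H V μ.1 := by
  have h1 : v ∈ lowerClosure b ⊤ S := by
    let N' : Submodule (Env 𝔤 A) V := { lowerClosure b ⊤ S with
      smul_mem' := fun u m hm ↦ env_smul_mem (fun x a m hm ↦ cur_mem_lowerClosure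
        (fun h a _ ↦ hcartan h a) (fun α hα x hx a _ ↦ hraise α hα x hx a) x (Submonoid.mem_top _) hm) u hm }
    have : N' = ⊤ := by
      rw [eq_top_iff, ← hgen, Submodule.span_le]
      exact le_lowerClosure ⊤ S
    have hv : v ∈ N' := this ▸ Submodule.mem_top
    exact hv
  refine lowerClosure_le le_sup_left ?_ h1
  intro α hα x hx a _ m hm
  have hne := (rootSystem H).ne_zero α
  obtain ⟨s, hs, t, ht, rfl⟩ := Submodule.mem_sup.1 hm
  refine Submodule.mem_sup_right ?_
  rw [smul_add]
  refine add_mem ?_ ?_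
  · refine Submodule.mem_iSup_of_mem ⟨lam + (rootSystem H).root α, ?_, ?_⟩
      (raise_mem_weightSpace (hS hs) α x hx a)
    · simpa using hα
    · simp
  · refine Submodule.iSup_induction _
      (motive := fun t ↦ (cur x a : Env 𝔤 A) • t ∈ ⨆ μ : {μ // lam - μ ∈ posCone b ∧ μ ≠ lam},
        wtSpace H V μ.1) ht ?_ ?_ ?_
    · rintro ⟨μ, hμ, hμ'⟩ y hy
      have h2 : lam - (μ + (rootSystem H).root α) = (lam - μ) + -(rootSystem H).root α := by abel
      refine Submodule.mem_iSup_of_mem ⟨μ + (rootSystem H).root α, ?_, fun h ↦ hne ?_⟩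
        (raise_mem_weightSpace hy α x hx a)
      · rw [h2]
        exact add_mem hμ hα
      · rw [← neg_eq_zero]
        refine eq_zero_of_posCone hα ?_
        rw [neg_neg]
        have h3 : (rootSystem H).root α = lam - μ := by rw [← h]; abel
        exact h3 ▸ hμ
    · rw [smul_zero]
      exact zero_mem _
    · intro y z hy hz
      rw [smul_add]
      exact add_mem hy hz

/-- The weights of a highest weight module lie in `λ - Q⁺`. -/
lemma sub_mem_posCone_of_wtSpace_ne_bot (hS : S ≤ wtSpace H V lam)
    (hcartan : ∀ (h : H) (a : A), ∀ s ∈ S, (cur (h : 𝔤) a : Env 𝔤 A) • s ∈ S)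
    (hraise : ∀ α : H.root, (rootSystem H).root α ∈ posCone b → ∀ x ∈ rootSpace H α.1, ∀ a : A,
      ∀ s ∈ S, (cur x a : Env 𝔤 A) • s = 0)
    (hgen : Submodule.span (Env 𝔤 A) (S : Set V) = ⊤) {μ : Module.Dual ℂ H}
    (hμ : wtSpace H V μ ≠ ⊥) : lam - μ ∈ posCone b := by
  by_contra hcon
  -- Independence makes this weight space disjoint from the sum of the others, which is already the
  -- whole module when `μ` is outside `λ - Q⁺`.
  refine hμ (disjoint_self.1 ((iSupIndep_wtSpace μ).mono_right fun v _ ↦ ?_))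
  refine (sup_le ?_ (iSup_le fun χ ↦ ?_) :
    S ⊔ ⨆ μ : {μ // lam - μ ∈ posCone b ∧ μ ≠ lam}, wtSpace H V μ.1 ≤ _)
    (top_le_sup_iSup_wtSpace hS hcartan hraise hgen v)
  · refine hS.trans (le_iSup₂_of_le lam (fun h ↦ hcon ?_) le_rfl)
    rw [h, sub_self]
    exact zero_mem _
  · exact le_iSup₂_of_le χ.1 (fun h ↦ hcon (h ▸ χ.2.1)) le_rfl

/-- The highest weight space is the space of the given generators. -/
lemma wtSpace_eq_of_span_eq_top (hS : S ≤ wtSpace H V lam)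
    (hcartan : ∀ (h : H) (a : A), ∀ s ∈ S, (cur (h : 𝔤) a : Env 𝔤 A) • s ∈ S)
    (hraise : ∀ α : H.root, (rootSystem H).root α ∈ posCone b → ∀ x ∈ rootSpace H α.1, ∀ a : A,
      ∀ s ∈ S, (cur x a : Env 𝔤 A) • s = 0)
    (hgen : Submodule.span (Env 𝔤 A) (S : Set V) = ⊤) : wtSpace H V lam = S := by
  refine le_antisymm (fun v hv ↦ ?_) hS
  obtain ⟨s, hs, t, ht, rfl⟩ :=
    Submodule.mem_sup.1 (top_le_sup_iSup_wtSpace hS hcartan hraise hgen v)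
  have h1 : t ∈ wtSpace H V lam := by simpa using sub_mem hv (hS hs)
  have h2 : t = 0 := Submodule.disjoint_def.1 (iSupIndep_wtSpace lam) t h1
    ((iSup_le fun χ ↦ le_iSup₂_of_le χ.1 χ.2.2 le_rfl :
      (⨆ μ : {μ // lam - μ ∈ posCone b ∧ μ ≠ lam}, wtSpace H V μ.1) ≤ _) ht)
  rwa [h2, add_zero]

end Generated

lemma nsmul_add_nsmul_neg {M : Type*} [AddCommGroup M] [Module ℂ M] (x y : M) {k N : ℕ}
    (hk : k ≤ N) : x + k • y + (N - k) • (-y) = x - ((N : ℂ) - 2 * k) • y := by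
  rw [← Nat.cast_smul_eq_nsmul ℂ, ← Nat.cast_smul_eq_nsmul ℂ, Nat.cast_sub hk]
  module

/-- When simple root vectors act locally nilpotently, the weights are stable under the simple
reflections. -/
lemma wtSpace_reflection_ne_bot {i : H.root} {h e f : 𝔤} (ht : IsSl2Triple h e f)
    (hh : h = ((rootSystem H).coroot i : H)) (he : e ∈ rootSpace H ((rootSystem H).root i))
    (hf : f ∈ rootSpace H (-(rootSystem H).root i : Module.Dual ℂ H))
    (he' : ∀ w : V, ∃ n : ℕ, (cur e 1 ^ n : Env 𝔤 A) • w = 0)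
    (hf' : ∀ w : V, ∃ n : ℕ, (cur f 1 ^ n : Env 𝔤 A) • w = 0)
    {μ : Module.Dual ℂ H} (hμ : wtSpace H V μ ≠ ⊥) :
    wtSpace H V ((rootSystem H).reflection i μ) ≠ ⊥ := by
  obtain ⟨v, hv, hv0⟩ := (Submodule.ne_bot_iff _).1 hμ
  rw [Submodule.ne_bot_iff]
  have hr : (rootSystem H).reflection i μ =
      μ - (μ ((rootSystem H).coroot i)) • (rootSystem H).root i :=
    (rootSystem H).reflection_apply i μ
  have hv1 : (cur h 1 : Env 𝔤 A) • v = μ ((rootSystem H).coroot i) • v := by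
    rw [hh]
    exact mem_wtSpace.1 hv _
  obtain ⟨k, N, h1, h2⟩ := exists_weight_string ht hv0 hv1 (he' v) hf'
  -- The string argument is run again with `e` and `f` exchanged. If both `N < k` and `N' < k'`,
  -- adding `c = N - 2 k` and `-c = N' - 2 k'` gives a contradiction, so one of the two vectors is
  -- available.
  obtain ⟨k', N', h3, h4⟩ := exists_weight_string ht.symm (c := -μ ((rootSystem H).coroot i)) hv0
    (by rw [cur_neg, neg_smul, hv1, neg_smul]) (hf' v) he'
  by_cases hk : k ≤ N
  · refine ⟨_, ?_, h2 hk⟩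
    have := cur_pow_mem_wtSpace (cur_pow_mem_wtSpace hv he 1 k) hf 1 (N - k)
    rwa [hr, h1, ← nsmul_add_nsmul_neg _ _ hk]
  · have hk' : k' ≤ N' := by
      by_contra hk'
      have : (N + N' : ℂ) = 2 * (k + k') := by linear_combination -h1 - h3
      have : N + N' = 2 * (k + k') := by exact_mod_cast this
      omega
    refine ⟨_, ?_, h4 hk'⟩
    have := cur_pow_mem_wtSpace (cur_pow_mem_wtSpace hv hf 1 k') he 1 (N' - k')
    have h5 := nsmul_add_nsmul_neg μ (-(rootSystem H).root i) hk'
    rw [← h3, neg_smul_neg, neg_neg] at h5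
    rwa [hr, ← h5]

/-- If the heights of the weights of `V` are bounded, a highest weight vector lies in a
finite-dimensional `𝔤`-stable subspace. -/
lemma exists_finiteDimensional_of_height_bound {lam : Module.Dual ℂ H} {K : ℕ}
    {φ : Module.Dual ℂ H →ₗ[ℂ] ℂ} (hφ : ∀ x ∈ posCone b, ∃ n : ℕ, φ x = n ∧ (n = 0 → x = 0))
    (hK : ∀ μ, wtSpace H V μ ≠ ⊥ → ∀ n : ℕ, φ (lam - μ) = n → n ≤ K) {v : V}
    (hv : v ∈ wtSpace H V lam)
    (hraise : ∀ α : H.root, (rootSystem H).root α ∈ posCone b → ∀ x ∈ rootSpace H α.1,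
      (cur x 1 : Env 𝔤 A) • v = 0) :
    ∃ F : Submodule ℂ V, FiniteDimensional ℂ F ∧
      (∀ (x : 𝔤), ∀ m ∈ F, (cur x 1 : Env 𝔤 A) • m ∈ F) ∧ v ∈ F := by
  let β : 𝔤 →ₗ[ℂ] V →ₗ[ℂ] V := LinearMap.mk₂ ℂ (fun x m ↦ (cur x 1 : Env 𝔤 A) • m)
    (fun x y m ↦ by rw [cur_add, add_smul]) (fun c x m ↦ by rw [cur_smul, smul_assoc])
    (fun x m n ↦ smul_add _ _ _) (fun c x m ↦ smul_comm _ _ _)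
  let nm : Set 𝔤 := {x | ∃ α : H.root, -(rootSystem H).root α ∈ posCone b ∧ x ∈ rootSpace H α.1}
  -- `D k` is spanned by products of exactly `k` lowering operators applied to `v`, and `T k` below
  -- collects the weights of height at least `k`. Each lowering operator adds at least one to the
  -- height, so `D (K + 1)` vanishes.
  let D : ℕ → Submodule ℂ V := fun k ↦
    Nat.rec (Submodule.span ℂ {v}) (fun _ D ↦ Submodule.map₂ β (Submodule.span ℂ nm) D) k
  have hDfg : ∀ k, (D k).FG := by
    intro k
    induction k with
    | zero => exact Submodule.fg_span_singleton v
    | succ k ih => exact Submodule.FG.map₂ β (IsNoetherian.noetherian _) ih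
  let T : ℕ → Submodule ℂ V := fun k ↦
    ⨆ μ : {μ // ∃ n : ℕ, k ≤ n ∧ φ (lam - μ) = n}, wtSpace H V μ.1
  have hDT : ∀ k, D k ≤ T k := by
    intro k
    induction k with
    | zero =>
      refine (Submodule.span_singleton_le_iff_mem _ _).2
        (Submodule.mem_iSup_of_mem ⟨lam, 0, le_rfl, ?_⟩ hv)
      rw [sub_self, map_zero, Nat.cast_zero]
    | succ k ih =>
      change Submodule.map₂ β (Submodule.span ℂ nm) (D k) ≤ _
      rw [Submodule.map₂_le]
      intro x hx d hd
      refine Submodule.span_induction (p := fun x _ ↦ β x d ∈ T (k + 1)) ?_ ?_ ?_ ?_ hx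
      · rintro x ⟨α, hα, hx⟩
        refine Submodule.iSup_induction _ (motive := fun t ↦ β x t ∈ T (k + 1)) (ih hd) ?_ ?_ ?_
        · rintro ⟨μ, n, hkn, hn⟩ y hy
          obtain ⟨m, hm, hm0⟩ := hφ _ hα
          refine Submodule.mem_iSup_of_mem ⟨μ + (rootSystem H).root α, n + m, ?_, ?_⟩
            (raise_mem_weightSpace hy α x hx 1)
          · have : m ≠ 0 := fun h ↦ (rootSystem H).ne_zero α (neg_eq_zero.1 (hm0 h))
            omega
          · have : lam - (μ + (rootSystem H).root α) = (lam - μ) + -(rootSystem H).root α := by abel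
            rw [this, map_add, hn, hm, Nat.cast_add]
        · rw [map_zero]
          exact zero_mem _
        · intro y z hy hz
          rw [map_add]
          exact add_mem hy hz
      · rw [map_zero, LinearMap.zero_apply]
        exact zero_mem _
      · intro x y _ _ hx hy
        rw [map_add, LinearMap.add_apply]
        exact add_mem hx hy
      · intro c x _ hx
        rw [map_smul, LinearMap.smul_apply]
        exact Submodule.smul_mem _ c hx
  have hbot : D (K + 1) = ⊥ := by
    refine eq_bot_iff.2 ((hDT (K + 1)).trans (iSup_le ?_))
    rintro ⟨μ, n, hn, hμ⟩
    by_contra hne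
    have := hK μ (fun h ↦ hne h.le) n hμ
    omega
  have hlow : LowerStable b (⊥ : Submonoid A) (⨆ k : Fin (K + 1), D k) := by
    rintro α hα x hx a ha m hm
    obtain rfl := Submonoid.mem_bot.1 ha
    refine Submodule.iSup_induction _
      (motive := fun m ↦ β x m ∈ ⨆ k : Fin (K + 1), D k) hm ?_ ?_ ?_
    · rintro ⟨k, hk⟩ y hy
      have h1 : β x y ∈ D (k + 1) :=
        Submodule.apply_mem_map₂ β (Submodule.subset_span ⟨α, hα, hx⟩) hy
      rcases Nat.lt_succ_iff_lt_or_eq.1 hk with hk' | rfl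
      · exact Submodule.mem_iSup_of_mem (⟨k + 1, by omega⟩ : Fin (K + 1)) h1
      · rw [hbot, Submodule.mem_bot] at h1
        rw [h1]
        exact zero_mem _
    · rw [map_zero]
      exact zero_mem _
    · intro y z hy hz
      rw [map_add]
      exact add_mem hy hz
  -- The lower closure of `v` for `𝔤` lies in `D 0 + ... + D K`, a finite sum of finite-dimensional
  -- spaces.
  have hle : lowerClosure b (⊥ : Submonoid A) (Submodule.span ℂ {v}) ≤ ⨆ k : Fin (K + 1), D k :=
    lowerClosure_le (le_iSup_of_le (0 : Fin (K + 1)) le_rfl) hlow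
  refine ⟨lowerClosure b (⊥ : Submonoid A) (Submodule.span ℂ {v}),
    
    Module.Finite.iff_fg.2 ((Submodule.fg_iSup _ fun k : Fin (K + 1) ↦ hDfg k).of_le hle), fun x m hm ↦ ?_,
    le_lowerClosure _ _ (Submodule.mem_span_singleton_self v)⟩
  refine cur_mem_lowerClosure ?_ ?_ x (one_mem _) hm
  · intro h a ha s hs
    obtain rfl := Submonoid.mem_bot.1 ha
    obtain ⟨c, rfl⟩ := Submodule.mem_span_singleton.1 hs
    rw [smul_comm, mem_wtSpace.1 hv h]
    exact Submodule.smul_mem _ c (Submodule.smul_mem _ _ (Submodule.mem_span_singleton_self v))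
  · intro α hα x hx a ha s hs
    obtain rfl := Submonoid.mem_bot.1 ha
    obtain ⟨c, rfl⟩ := Submodule.mem_span_singleton.1 hs
    rw [smul_comm, hraise α hα x hx, smul_zero]

/-- A module generated by highest weight vectors of dominant weight `λ` that satisfy the relations
of the global Weyl module belongs to `I_A^λ`. -/
lemma boundedIntegrable_of_span_eq_top {lam : Module.Dual ℂ H} (hlam : IsDominantIntegral b lam)
    {S : Submodule ℂ V} (hS : S ≤ wtSpace H V lam)
    (hcartan : ∀ (h : H) (a : A), ∀ s ∈ S, (cur (h : 𝔤) a : Env 𝔤 A) • s ∈ S)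
    (hrel : ∀ u : Env 𝔤 A, WeylRel b A lam u → ∀ s ∈ S, u • s = 0)
    (hgen : Submodule.span (Env 𝔤 A) (S : Set V) = ⊤) : boundedIntegrable b A lam V := by
  have hraise : ∀ α : H.root, (rootSystem H).root α ∈ posCone b → ∀ x ∈ rootSpace H α.1, ∀ a : A,
      ∀ s ∈ S, (cur x a : Env 𝔤 A) • s = 0 := fun α hα x hx a ↦ hrel _ (.raise α hα x hx a)
  have hwt : ∀ μ, wtSpace H V μ ≠ ⊥ → lam - μ ∈ posCone b := fun μ hμ ↦
    sub_mem_posCone_of_wtSpace_ne_bot hS hcartan hraise hgen hμ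
  obtain ⟨φ, hφ⟩ := exists_height b
  -- The set of weights is reflection-stable because simple root vectors act locally nilpotently.
  -- They are ad-nilpotent and nilpotent on the generators: `e` kills `S`, and so does `f ^ (n + 1)`
  -- with `n = λ(h_i)`, where dominance enters.
  obtain ⟨K, hK⟩ := exists_height_bound b hφ lam (Ω := {μ | wtSpace H V μ ≠ ⊥}) (by
    intro μ hμ i hi
    have hi0 : i.1.IsNonZero := LieSubalgebra.isNonZero_coe_root i
    obtain ⟨y, hy, hy0⟩ := (-i.1).exists_ne_zero
    obtain ⟨e, he, ht⟩ := exists_sl2 i y hy hy0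
    obtain ⟨n, hn⟩ := hlam i hi
    refine wtSpace_reflection_ne_bot ht rfl he hy (fun w ↦ ?_) (fun w ↦ ?_) hμ
    · refine exists_cur_pow_smul_eq_zero (isNilpotent_ad_of_mem_rootSpace H
        hi0 he) (fun s hs ↦ ⟨1, ?_⟩) hgen w
      rw [pow_one]
      exact hraise i (AddSubmonoid.subset_closure ⟨i, hi, rfl⟩) e he 1 s hs
    · exact exists_cur_pow_smul_eq_zero (isNilpotent_ad_of_mem_rootSpace H
        hi0.neg hy)
        (fun s hs ↦ ⟨n + 1, hrel _ (.lower i hi y hy n hn) s hs⟩) hgen w) hwt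
  refine ⟨IsIntegrable.of_span_eq_top (fun s hs ↦ ?_) hgen, fun μ hμ ↦ hwt μ fun h ↦ hμ ?_⟩
  · exact exists_finiteDimensional_of_height_bound hφ (fun μ hμ ↦ hK μ hμ) (hS hs)
      fun α hα x hx ↦ hraise α hα x hx 1 s hs
  · rw [eq_bot_iff]
    intro v hv
    exact (Submodule.mem_bot _).2 ((Submodule.mem_bot ℂ).1 (h ▸ mem_wtSpace'.2 hv))

end HighestWeight

/-! ### The functor `𝐖` and its adjunction with `𝐑` -/

section WeylFunctor

variable {𝔤 : Type u} [LieRing 𝔤] [LieAlgebra ℂ 𝔤] [FiniteDimensional ℂ 𝔤]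
  [LieAlgebra.IsSimple ℂ 𝔤] {H : LieSubalgebra ℂ 𝔤} [H.IsCartanSubalgebra]
  {b : (rootSystem H).Base} {A : Type u} [CommRing A] [Algebra ℂ A] {lam : Module.Dual ℂ H}

lemma smul_wLam_surjective (w : GlobalWeyl b A lam) : ∃ u : Env 𝔤 A, u • wLam b A lam = w := by
  induction w using Submodule.Quotient.induction_on with
  | H u => exact ⟨u, congrArg Submodule.Quotient.mk (mul_one u)⟩

lemma smul_wLam_eq_zero_iff {u : Env 𝔤 A} :
    u • wLam b A lam = 0 ↔ u ∈ weylIdeal b A lam := by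
  rw [← Submodule.Quotient.mk_eq_zero, ← mul_one u]
  simp only [mul_one]
  exact Eq.congr_left (congrArg Submodule.Quotient.mk (mul_one u))

lemma mk_smul_wLam (c : CartanEnv H A) :
    Ideal.Quotient.mk (annW b A lam) c • wLam b A lam = (c : Env 𝔤 A) • wLam b A lam :=
  congrArg Submodule.Quotient.mk ((one_mul (c : Env 𝔤 A)).trans (mul_one _).symm)

variable (M : ModuleCat.{u} (ALam b A lam))

/-- The vector `w_λ ⊗ m` of `𝐖_A^λ M`. -/
def topVec (m : M) : weylObj b A lam M := (wLam b A lam ⊗ₜ[ALam b A lam] m :)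

variable {M}

lemma smul_topVec (u : Env 𝔤 A) (m : M) :
    u • topVec M m = ((u • wLam b A lam) ⊗ₜ[ALam b A lam] m :) := rfl

/-- On the generator `w_λ` the left and right actions of `U(𝔥 ⊗ A)` agree, so `c` slides across the
tensor sign. -/
lemma cartan_smul_topVec (c : CartanEnv H A) (m : M) :
    (c : Env 𝔤 A) • topVec M m = topVec M (Ideal.Quotient.mk (annW b A lam) c • m) := by
  rw [smul_topVec, ← mk_smul_wLam, TensorProduct.smul_tmul]
  rfl

lemma topVec_add (m n : M) : topVec M (m + n) = topVec M m + topVec M n :=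
  TensorProduct.tmul_add _ _ _

variable (M) in
/-- The space of all `w_λ ⊗ m`. -/
def topSpace : Submodule ℂ (weylObj b A lam M) where
  carrier := Set.range (topVec M)
  add_mem' := by
    rintro _ _ ⟨m, rfl⟩ ⟨n, rfl⟩
    exact ⟨m + n, topVec_add m n⟩
  zero_mem' := ⟨0, TensorProduct.tmul_zero _ _⟩
  smul_mem' := by
    rintro c _ ⟨m, rfl⟩
    rw [← algebraMap_smul (Env 𝔤 A) c]
    exact ⟨_, (cartan_smul_topVec (algebraMap ℂ (CartanEnv H A) c) m).symm⟩

lemma topVec_mem_topSpace (m : M) : topVec M m ∈ topSpace M := ⟨m, rfl⟩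

lemma span_topSpace : Submodule.span (Env 𝔤 A) (topSpace M : Set (weylObj b A lam M)) = ⊤ := by
  rw [eq_top_iff]
  rintro x -
  induction (x : GlobalWeyl b A lam ⊗[ALam b A lam] M) using TensorProduct.induction_on with
  | zero => exact zero_mem _
  | tmul w m =>
    obtain ⟨u, rfl⟩ := smul_wLam_surjective w
    exact Submodule.smul_mem _ u (Submodule.subset_span (topVec_mem_topSpace m))
  | add x y hx hy => exact add_mem hx hy

lemma weylRel_smul_topVec {u : Env 𝔤 A} (hu : WeylRel b A lam u) (m : M) :
    u • topVec M m = 0 := by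
  rw [smul_topVec, smul_wLam_eq_zero_iff.2 (Submodule.subset_span hu), TensorProduct.zero_tmul]
  rfl

lemma topVec_mem_weightSpace (m : M) :
    topVec M m ∈ weightSpace H A (weylObj b A lam M) lam := by
  intro h
  rw [← sub_eq_zero, ← sub_smul]
  exact weylRel_smul_topVec (.weight h) m

lemma topSpace_le_wtSpace : topSpace M ≤ wtSpace H (weylObj b A lam M) lam := by
  rintro _ ⟨m, rfl⟩
  exact topVec_mem_weightSpace m

lemma cur_cartan_mem_topSpace (h : H) (a : A) (s : weylObj b A lam M) (hs : s ∈ topSpace M) :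
    (cur (h : 𝔤) a : Env 𝔤 A) • s ∈ topSpace M := by
  obtain ⟨m, rfl⟩ := hs
  exact ⟨_, (cartan_smul_topVec ⟨_, cur_mem H A h a⟩ m).symm⟩

lemma weylRel_smul_topSpace (u : Env 𝔤 A) (hu : WeylRel b A lam u) (s : weylObj b A lam M)
    (hs : s ∈ topSpace M) : u • s = 0 := by
  obtain ⟨m, rfl⟩ := hs
  exact weylRel_smul_topVec hu m

/-- This is surjectivity of the unit `M → 𝐑 𝐖 M`; its injectivity is `topVec_injective`. -/
lemma wtSpace_weylObj : wtSpace H (weylObj b A lam M) lam = topSpace M :=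
  wtSpace_eq_of_span_eq_top topSpace_le_wtSpace cur_cartan_mem_topSpace
    (fun α hα x hx a ↦ weylRel_smul_topSpace _ (.raise α hα x hx a)) span_topSpace

lemma boundedIntegrable_weylObj (hlam : IsDominantIntegral b lam)
    (M : ModuleCat.{u} (ALam b A lam)) : boundedIntegrable b A lam (weylObj b A lam M) :=
  boundedIntegrable_of_span_eq_top hlam topSpace_le_wtSpace cur_cartan_mem_topSpace
    weylRel_smul_topSpace span_topSpace

lemma weylObj_hom_ext {V : ModuleCat.{u} (Env 𝔤 A)} {f g : weylObj b A lam M →ₗ[Env 𝔤 A] V}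
    (h : ∀ m, f (topVec M m) = g (topVec M m)) : f = g := by
  refine LinearMap.ext_on span_topSpace ?_
  rintro _ ⟨m, rfl⟩
  exact h m

lemma map_mem_weightSpace {V W : ModuleCat.{u} (Env 𝔤 A)} (f : V →ₗ[Env 𝔤 A] W)
    {μ : Module.Dual ℂ H} {v : V} (hv : v ∈ weightSpace H A V μ) : f v ∈ weightSpace H A W μ :=
  fun h ↦ by rw [← map_smul, hv h, map_smul]

/-- A shortcut that speeds up the instance search. -/
instance (V : BoundedCat b A lam) : SMul (ALam b A lam) (weightSpace H A V.obj lam) :=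
  Module.toDistribMulAction.toSMul

lemma mk_smul_coe {V : BoundedCat b A lam} (c : CartanEnv H A)
    (v : weightSpace H A V.obj lam) :
    ((Ideal.Quotient.mk (annW b A lam) c • v : weightSpace H A V.obj lam) : V.obj) =
      (c : Env 𝔤 A) • (v : V.obj) := rfl

/-- The map `M → 𝐑_A^λ V` adjoint to `𝐖_A^λ M → V`. -/
def weylAdjoint {V : BoundedCat b A lam} (f : weylObj b A lam M →ₗ[Env 𝔤 A] V.obj) :
    M →ₗ[ALam b A lam] restrObj V where
  toFun m := (⟨f (topVec M m), map_mem_weightSpace f (topVec_mem_weightSpace m)⟩ :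
    weightSpace H A V.obj lam)
  map_add' m n := Subtype.ext ((congrArg f (topVec_add m n)).trans (map_add f _ _))
  map_smul' c m := by
    obtain ⟨c, rfl⟩ := Ideal.Quotient.mk_surjective c
    refine Subtype.ext ?_
    change f (topVec M _) = (c : Env 𝔤 A) • f (topVec M m)
    rw [← cartan_smul_topVec, map_smul]

/-- The map `W_A(λ) → V` sending `w_λ` to a vector of `V_λ`. -/
def globalWeylDesc {V : BoundedCat b A lam} (v : weightSpace H A V.obj lam) :
    GlobalWeyl b A lam →ₗ[Env 𝔤 A] V.obj :=
  (weylIdeal b A lam).liftQ (LinearMap.toSpanSingleton (Env 𝔤 A) V.obj v)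
    fun _ hu ↦ weylIdeal_smul_eq_zero V hu v.2

lemma globalWeylDesc_wLam {V : BoundedCat b A lam} (v : weightSpace H A V.obj lam) :
    globalWeylDesc v (wLam b A lam) = (v : V.obj) :=
  one_smul (Env 𝔤 A) (v : V.obj)

lemma globalWeylDesc_smul_wLam {V : BoundedCat b A lam} (v : weightSpace H A V.obj lam)
    (u : Env 𝔤 A) : globalWeylDesc v (u • wLam b A lam) = u • (v : V.obj) := by
  rw [map_smul, globalWeylDesc_wLam]

/-- The pairing `W_A(λ) × V_λ → V`, `(u w_λ, v) ↦ u v`. -/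
def globalWeylPairing (V : BoundedCat b A lam) :
    GlobalWeyl b A lam →+ weightSpace H A V.obj lam →+ V.obj :=
  AddMonoidHom.mk' (fun w ↦ AddMonoidHom.mk' (fun v ↦ globalWeylDesc v w) fun v v' ↦ by
      obtain ⟨u, rfl⟩ := smul_wLam_surjective w
      simp only [globalWeylDesc_smul_wLam, Submodule.coe_add, smul_add])
    fun w w' ↦ AddMonoidHom.ext fun v ↦ (globalWeylDesc v).map_add w w'

lemma globalWeylPairing_smul_wLam {V : BoundedCat b A lam} (v : weightSpace H A V.obj lam)
    (u : Env 𝔤 A) : globalWeylPairing V (u • wLam b A lam) v = u • (v : V.obj) :=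
  globalWeylDesc_smul_wLam v u

lemma globalWeylPairing_smul {V : BoundedCat b A lam} (u : Env 𝔤 A) (w : GlobalWeyl b A lam)
    (v : weightSpace H A V.obj lam) :
    globalWeylPairing V (u • w) v = u • globalWeylPairing V w v :=
  (globalWeylDesc v).map_smul u w

/-- This is the balancing condition that lets the pairing descend to the tensor product over `𝐀_λ`:
with `w = u w_λ`, both sides are `u c v`. -/
lemma globalWeylPairing_smul_comm {V : BoundedCat b A lam} (c : ALam b A lam)
    (w : GlobalWeyl b A lam) (v : weightSpace H A V.obj lam) :
    globalWeylPairing V (c • w) v = globalWeylPairing V w (c • v) := by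
  obtain ⟨c, rfl⟩ := Ideal.Quotient.mk_surjective c
  obtain ⟨u, rfl⟩ := smul_wLam_surjective w
  rw [smul_comm, mk_smul_wLam, ← mul_smul, globalWeylPairing_smul_wLam,
    globalWeylPairing_smul_wLam, mk_smul_coe, mul_smul]

/-- The additive map underlying `weylDesc`. -/
def weylDescAux {V : BoundedCat b A lam} (φ : M →ₗ[ALam b A lam] weightSpace H A V.obj lam) :
    GlobalWeyl b A lam ⊗[ALam b A lam] M →+ V.obj :=
  TensorProduct.liftAddHom
    ((AddMonoidHom.compHom' (φ : M →+ weightSpace H A V.obj lam)).comp (globalWeylPairing V))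
    fun c w m ↦ (globalWeylPairing_smul_comm c w (φ m)).trans
      (congrArg (globalWeylPairing V w) (φ.map_smul c m).symm)

lemma weylDescAux_smul {V : BoundedCat b A lam}
    (φ : M →ₗ[ALam b A lam] weightSpace H A V.obj lam) (u : Env 𝔤 A)
    (x : GlobalWeyl b A lam ⊗[ALam b A lam] M) :
    weylDescAux φ (u • x) = u • weylDescAux φ x := by
  induction x using TensorProduct.induction_on with
  | zero => simp
  | tmul w m => exact globalWeylPairing_smul u w (φ m)
  | add x y hx hy => rw [smul_add, map_add, map_add, hx, hy, smul_add]

/-- The map `𝐖_A^λ M → V` adjoint to `M → 𝐑_A^λ V`. -/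
def weylDesc {V : BoundedCat b A lam} (φ : M →ₗ[ALam b A lam] restrObj V) :
    weylObj b A lam M →ₗ[Env 𝔤 A] V.obj where
  toFun := weylDescAux (V := V) φ
  map_add' := map_add (weylDescAux (V := V) φ)
  map_smul' := weylDescAux_smul (V := V) φ

lemma weylDesc_topVec {V : BoundedCat b A lam} (φ : M →ₗ[ALam b A lam] restrObj V) (m : M) :
    weylDesc φ (topVec M m) = (show weightSpace H A V.obj lam from φ m : V.obj) :=
  globalWeylDesc_wLam _

end WeylFunctor

/-! ### Splitting off the highest weight space of `W_A(λ)` -/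

section TopProjection

variable {𝔤 : Type u} [LieRing 𝔤] [LieAlgebra ℂ 𝔤] [FiniteDimensional ℂ 𝔤]
  [LieAlgebra.IsSimple ℂ 𝔤] {H : LieSubalgebra ℂ 𝔤} [H.IsCartanSubalgebra]
  {b : (rootSystem H).Base} {A : Type u} [CommRing A] [Algebra ℂ A] {lam : Module.Dual ℂ H}

variable (b A lam) in
/-- `W_A(λ)` as an object of the category of `𝔤 ⊗ A`-modules. -/
def globalWeylObj : ModuleCat.{u} (Env 𝔤 A) := ModuleCat.of (Env 𝔤 A) (GlobalWeyl b A lam)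

/-- The highest weight space `U(𝔥 ⊗ A) w_λ` of `W_A(λ)`. -/
def globalTop : Submodule ℂ (globalWeylObj b A lam) where
  carrier := Set.range fun c : CartanEnv H A ↦ (c : Env 𝔤 A) • wLam b A lam
  add_mem' := by
    rintro _ _ ⟨c, rfl⟩ ⟨d, rfl⟩
    exact ⟨c + d, add_smul (c : Env 𝔤 A) (d : Env 𝔤 A) _⟩
  zero_mem' := ⟨0, zero_smul (Env 𝔤 A) _⟩
  smul_mem' := by
    rintro r _ ⟨c, rfl⟩
    refine ⟨algebraMap ℂ _ r * c, ?_⟩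
    exact mul_smul (algebraMap ℂ (Env 𝔤 A) r) (c : Env 𝔤 A) _

lemma mul_smul_wLam_of_weylRel {u : Env 𝔤 A} (hu : WeylRel b A lam u) (c : CartanEnv H A) :
    u • (c : Env 𝔤 A) • wLam b A lam = 0 := by
  rw [← mul_smul, smul_wLam_eq_zero_iff]
  exact weylIdeal_mul_mem (Submodule.subset_span hu) c

lemma smul_wLam_mem_weightSpace (c : CartanEnv H A) :
    (c : Env 𝔤 A) • wLam b A lam ∈ weightSpace H A (GlobalWeyl b A lam) lam := by
  intro h
  rw [← sub_eq_zero, ← sub_smul]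
  exact mul_smul_wLam_of_weylRel (.weight h) c

lemma aLam_smul_mem_weightSpace {μ : Module.Dual ℂ H} {w : GlobalWeyl b A lam}
    (hw : w ∈ weightSpace H A (GlobalWeyl b A lam) μ) (c : ALam b A lam) :
    c • w ∈ weightSpace H A (GlobalWeyl b A lam) μ := by
  intro h
  rw [← smul_comm, hw h, smul_comm]

variable (b A lam) in
/-- The sum of the weight spaces of `W_A(λ)` for the weights other than `λ`. -/
def otherWeights : Submodule ℂ (globalWeylObj b A lam) :=
  ⨆ μ : {μ // lam - μ ∈ posCone b ∧ μ ≠ lam}, wtSpace H (globalWeylObj b A lam) μ.1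

lemma disjoint_otherWeights :
    Disjoint (wtSpace H (globalWeylObj b A lam) lam) (otherWeights b A lam) :=
  (iSupIndep_wtSpace lam).mono_right
    (iSup_le fun χ ↦ le_iSup₂_of_le χ.1 χ.2.2 le_rfl)

lemma aLam_smul_mem_otherWeights {w : GlobalWeyl b A lam}
    (hw : w ∈ otherWeights b A lam) (c : ALam b A lam) :
    c • w ∈ otherWeights b A lam := by
  let f : globalWeylObj b A lam →+ globalWeylObj b A lam :=
    DistribSMul.toAddMonoidHom (GlobalWeyl b A lam) c
  have hf : ∀ w ∈ otherWeights b A lam, f w ∈ otherWeights b A lam := by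
    intro w hw
    refine Submodule.iSup_induction _ (motive := fun w ↦ f w ∈ otherWeights b A lam) hw ?_ ?_ ?_
    · exact fun μ w hw ↦ Submodule.mem_iSup_of_mem μ (aLam_smul_mem_weightSpace hw c)
    · rw [map_zero]
      exact zero_mem _
    · intro w w' h h'
      rw [map_add]
      exact add_mem h h'
  exact hf w hw

variable (b A lam) in
/-- `otherWeights` as an `𝐀_λ`-submodule. -/
def globalBottom : Submodule (ALam b A lam) (GlobalWeyl b A lam) where
  carrier := {w | w ∈ otherWeights b A lam}
  add_mem' h h' := Submodule.add_mem (otherWeights b A lam) h h'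
  zero_mem' := Submodule.zero_mem (otherWeights b A lam)
  smul_mem' c _ hw := aLam_smul_mem_otherWeights hw c

lemma mem_globalTop_sup (w : GlobalWeyl b A lam) :
    ∃ (c : CartanEnv H A) (t : GlobalWeyl b A lam), t ∈ otherWeights b A lam ∧
      (c : Env 𝔤 A) • wLam b A lam + t = w := by
  have := top_le_sup_iSup_wtSpace (b := b) (V := globalWeylObj b A lam)
    (lam := lam) (S := globalTop) ?_ ?_ ?_ ?_ w
  · obtain ⟨_, ⟨c, rfl⟩, t, ht, h⟩ := Submodule.mem_sup.1 this
    exact ⟨c, t, ht, h⟩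
  · rintro _ ⟨c, rfl⟩
    exact smul_wLam_mem_weightSpace c
  · rintro h a _ ⟨c, rfl⟩
    exact ⟨⟨_, cur_mem H A h a⟩ * c, mul_smul (cur (h : 𝔤) a : Env 𝔤 A) (c : Env 𝔤 A) _⟩
  · rintro α hα x hx a _ ⟨c, rfl⟩
    exact mul_smul_wLam_of_weylRel (.raise α hα x hx a) c
  · rw [eq_top_iff]
    rintro w -
    obtain ⟨u, rfl⟩ := smul_wLam_surjective (w : GlobalWeyl b A lam)
    exact Submodule.smul_mem _ u (Submodule.subset_span ⟨1, one_smul (Env 𝔤 A) _⟩)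

lemma injective_toSpanSingleton_wLam :
    Function.Injective (LinearMap.toSpanSingleton (ALam b A lam) _ (wLam b A lam)) := by
  rw [injective_iff_map_eq_zero]
  intro c hc
  obtain ⟨c, rfl⟩ := Ideal.Quotient.mk_surjective c
  rw [LinearMap.toSpanSingleton_apply, mk_smul_wLam] at hc
  exact Ideal.Quotient.eq_zero_iff_mem.2 hc

/-- The orbit of `w_λ` under `𝐀_λ` lies in weight `λ`, and the remaining weights supply the
complement. The latter is an `𝐀_λ`-submodule because the right action commutes with `𝔥`. -/
lemma isCompl_globalBottom :
    IsCompl (LinearMap.range (LinearMap.toSpanSingleton (ALam b A lam) _ (wLam b A lam)))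
      (globalBottom b A lam) := by
  refine ⟨Submodule.disjoint_def.2 ?_, codisjoint_iff.2 (eq_top_iff.2 fun w _ ↦ ?_)⟩
  · rintro _ ⟨c, rfl⟩ h
    obtain ⟨c, rfl⟩ := Ideal.Quotient.mk_surjective c
    rw [LinearMap.toSpanSingleton_apply, mk_smul_wLam] at *
    exact Submodule.disjoint_def.1 disjoint_otherWeights _ (smul_wLam_mem_weightSpace c) h
  · obtain ⟨c, t, ht, rfl⟩ := mem_globalTop_sup w
    exact Submodule.add_mem _ (Submodule.mem_sup_left ⟨Ideal.Quotient.mk _ c, mk_smul_wLam c⟩)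
      (Submodule.mem_sup_right ht)

/-- `𝐀_λ` is a direct summand of `W_A(λ)`. -/
lemma exists_retraction_wLam :
    ∃ p : GlobalWeyl b A lam →ₗ[ALam b A lam] ALam b A lam, p (wLam b A lam) = 1 := by
  let e := LinearEquiv.ofInjective _ (injective_toSpanSingleton_wLam (b := b) (A := A) (lam := lam))
  refine ⟨e.symm.toLinearMap ∘ₗ Submodule.projectionOnto _ _ isCompl_globalBottom, ?_⟩
  rw [LinearMap.comp_apply, LinearEquiv.coe_coe, LinearEquiv.symm_apply_eq]
  have h : (e 1 : GlobalWeyl b A lam) = wLam b A lam := one_smul (ALam b A lam) _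
  exact (congrArg _ h.symm).trans (Submodule.projectionOnto_apply_left _ (e 1))

/-- Tensoring a retraction `W_A(λ) → 𝐀_λ` with `M` gives a left inverse, so no flatness is needed.
-/
lemma topVec_injective {M : ModuleCat.{u} (ALam b A lam)} :
    Function.Injective (topVec M) := by
  obtain ⟨p, hp⟩ := exists_retraction_wLam (b := b) (A := A) (lam := lam)
  let q : GlobalWeyl b A lam ⊗[ALam b A lam] M →ₗ[ALam b A lam] M :=
    (TensorProduct.lid (ALam b A lam) M).toLinearMap ∘ₗ LinearMap.rTensor M p
  refine Function.LeftInverse.injective (g := q) fun m ↦ ?_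
  change q (wLam b A lam ⊗ₜ m) = m
  simp [q, hp]

end TopProjection

/-! ### Exactness of the weight space functor -/

section WeightLifting

/-- There is no Jordan block of `h` on vectors killed by `e`. If `u = (h - n) v` were nonzero, it
would be primitive of weight `n`, with `f ^ k u` nonzero exactly for `k ≤ n`. This clashes with `e f
^ (k + 1) v = (k + 1) ((n - k) f ^ k v + f ^ k u)` at the last `k` for which `f ^ k v` is nonzero.
-/
lemma lie_h_eq_smul_of_sq {L M : Type*} [LieRing L] [LieAlgebra ℂ L] [AddCommGroup M] [Module ℂ M]
    [LieRingModule L M] [LieModule ℂ L M] [FiniteDimensional ℂ M] {h e f : L}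
    (t : IsSl2Triple h e f) (hf : IsNilpotent (LieModule.toEnd ℂ L M f)) {n : ℕ} {v : M}
    (he : ⁅e, v⁆ = 0) (hh : ⁅h, ⁅h, v⁆ - (n : ℂ) • v⁆ = (n : ℂ) • (⁅h, v⁆ - (n : ℂ) • v)) :
    ⁅h, v⁆ = (n : ℂ) • v := by
  set u := ⁅h, v⁆ - (n : ℂ) • v with hu
  by_contra hne
  have hu0 : u ≠ 0 := sub_ne_zero.2 hne
  have hv : ⁅h, v⁆ = (n : ℂ) • v + u := by rw [hu]; abel
  have P : t.HasPrimitiveVectorWith u (n : ℂ) :=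
    { ne_zero := hu0
      lie_h := hh
      lie_e := by
        rw [hu, lie_sub, lie_smul, he, smul_zero, sub_zero, leibniz_lie, he, lie_zero, add_zero,
          ← lie_skew, t.lie_h_e_smul ℂ, neg_lie, smul_lie, he, smul_zero, neg_zero] }
  let ψ : ℕ → M → M := fun k w ↦ (LieModule.toEnd ℂ L M f ^ k) w
  have hψ : ∀ k w, ⁅f, ψ k w⁆ = ψ (k + 1) w := fun k w ↦ by simp [ψ, pow_succ']
  have h1 : ∀ k : ℕ, ⁅h, ψ k v⁆ = ((n : ℂ) - 2 * k) • ψ k v + ψ k u := by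
    intro k
    induction k with
    | zero => simpa [ψ] using hv
    | succ k ih =>
      rw [← hψ, leibniz_lie, ih, t.lie_lie_smul_f ℂ, neg_lie, smul_lie, lie_add, lie_smul, hψ, hψ]
      push_cast
      module
  have h2 : ∀ k : ℕ, ⁅e, ψ (k + 1) v⁆ =
      (((k : ℂ) + 1) * (n - k)) • ψ k v + ((k : ℂ) + 1) • ψ k u := by
    intro k
    induction k with
    | zero =>
      rw [← hψ, leibniz_lie, t.lie_e_f, h1]
      simp [ψ, he]
    | succ k ih =>
      rw [← hψ, leibniz_lie, t.lie_e_f, h1, ih, lie_add, lie_smul, lie_smul, hψ, hψ]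
      push_cast
      module
  have hu1 : ∀ k ≤ n, ψ k u ≠ 0 := fun k hk ↦ P.pow_toEnd_f_ne_zero_of_eq_nat rfl hk
  have hu2 : ∀ k, n < k → ψ k u = 0 := fun k hk ↦
    Module.End.pow_map_zero_of_le hk (P.pow_toEnd_f_eq_zero_of_eq_nat (n := n) rfl)
  have hv0 : v ≠ 0 := by
    rintro rfl
    exact hu0 (by simp [hu])
  obtain ⟨k, hk, hk'⟩ := Nat.exists_not_and_succ_of_not_zero_of_exists
    (p := fun k ↦ ψ k v = 0) (by simpa [ψ] using hv0)
    (by obtain ⟨k, hk⟩ := hf; exact ⟨k, by simp [ψ, hk]⟩)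
  have h3 := h2 k
  rw [hk', lie_zero, mul_smul, ← smul_add, eq_comm, smul_eq_zero_iff_right
    (Nat.cast_add_one_ne_zero k)] at h3
  -- Now `(n - k) f ^ k v + f ^ k u = 0`. For `k < n`, applying `f ^ (n - k)` gives `f ^ n u = 0`;
  -- for `k = n` this is immediate; for `k > n` the `u` term is zero and `f ^ k v` would vanish.
  rcases lt_trichotomy k n with hlt | rfl | hlt
  · have h4 := congrArg (ψ (n - k)) h3
    have h5 : ∀ w, ψ (n - k) (ψ k w) = ψ n w := fun w ↦ by
      simp only [ψ]
      rw [← Module.End.mul_apply, ← pow_add, Nat.sub_add_cancel hlt.le]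
    have h6 : ψ n v = 0 := Module.End.pow_map_zero_of_le hlt hk'
    have h7 : ψ (n - k) (((n : ℂ) - k) • ψ k v + ψ k u) = ((n : ℂ) - k) • ψ n v + ψ n u := by
      rw [← h5, ← h5]
      simp only [ψ, map_add, map_smul]
    rw [h7, h6, smul_zero, zero_add] at h4
    exact hu1 n le_rfl (h4.trans (map_zero _))
  · rw [sub_self, zero_smul, zero_add] at h3
    exact hu1 k le_rfl h3
  · rw [hu2 k hlt, add_zero, smul_eq_zero_iff_left hk, sub_eq_zero] at h3
    exact hlt.ne (by exact_mod_cast h3)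

variable {𝔤 : Type u} [LieRing 𝔤] [LieAlgebra ℂ 𝔤] [FiniteDimensional ℂ 𝔤]
  [LieAlgebra.IsSimple ℂ 𝔤] {H : LieSubalgebra ℂ 𝔤} [H.IsCartanSubalgebra]
  {b : (rootSystem H).Base} {A : Type u} [CommRing A] [Algebra ℂ A] {lam : Module.Dual ℂ H}

/-- Every vector of `V` is the sum of a vector of weight `λ` and of generalized weight vectors of
other weights, for `V` in `I_A^λ` and `λ` dominant. -/
lemma exists_mem_weightSpace_add (hlam : IsDominantIntegral b lam) (V : BoundedCat b A lam)
    (v : V.obj) :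
    letI := lieRingModule (𝔤 := 𝔤) (A := A) V.obj
    haveI := lieModule (𝔤 := 𝔤) (A := A) V.obj
    ∃ v₀ ∈ weightSpace H A V.obj lam, ∃ v₁ ∈ ⨆ χ : H → ℂ, ⨆ _ : χ ≠ lam,
      genWeightSpace V.obj χ, v₀ + v₁ = v := by
  let i1 := lieRingModule (𝔤 := 𝔤) (A := A) V.obj
  have i2 := lieModule (𝔤 := 𝔤) (A := A) V.obj
  obtain ⟨F, hF, hvF⟩ := V.property.1.exists_lieSubmodule v
  -- The main point is that generalized weight vectors of weight `λ` are genuine weight vectors.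
  have hwt : ∀ w ∈ genWeightSpace F (lam : H → ℂ), (w : V.obj) ∈ weightSpace H A V.obj lam := by
    intro w hw
    have hraise : ∀ i ∈ b.support, ∀ e ∈ rootSpace H i.1, ∀ w ∈ genWeightSpace F (lam : H → ℂ),
        ⁅e, w⁆ = 0 := by
      intro i hi e he w hw
      -- A nonzero `⁅e, w⁆` would make `λ + α_i` a generalized weight of `F`, hence a genuine weight
      -- of `V` outside `λ - Q⁺`.
      have h1 := LieAlgebra.lie_mem_genWeightSpace_of_mem_genWeightSpace he hw
      by_contra hne
      have hbot : genWeightSpace F ((i.1 : H → ℂ) + (lam : H → ℂ)) ≠ ⊥ := fun h ↦ hne (by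
        rwa [h, LieSubmodule.mem_bot] at h1)
      obtain ⟨m, hm0, hm⟩ := LieModule.exists_forall_lie_eq_smul ℂ H F
        (⟨_, hbot⟩ : LieModule.Weight ℂ H F)
      have h2 : (m : V.obj) ∈ weightSpace H A V.obj (lam + (rootSystem H).root i) := fun h ↦ by
        rw [algebraMap_smul, add_comm]
        exact congrArg Subtype.val (hm h)
      have h3 := V.property.2 _ ((Submodule.ne_bot_iff _).2 ⟨_, h2, fun h ↦ hm0 (Subtype.ext h)⟩)
      rw [sub_add_cancel_left] at h3
      exact (rootSystem H).ne_zero i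
        (eq_zero_of_posCone (AddSubmonoid.subset_closure ⟨i, hi, rfl⟩) h3)
    have hsimple : ∀ i ∈ b.support, ⁅(((rootSystem H).coroot i : H) : 𝔤), w⁆ =
        lam ((rootSystem H).coroot i) • w := by
      intro i hi
      have hi0 : i.1.IsNonZero := LieSubalgebra.isNonZero_coe_root i
      obtain ⟨y, hy, hy0⟩ := (-i.1).exists_ne_zero
      obtain ⟨e, he, ht⟩ := exists_sl2 i y hy hy0
      obtain ⟨n, hn⟩ := hlam i hi
      have hnil : IsNilpotent (LieModule.toEnd ℂ 𝔤 F y) :=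
        LieModule.isNilpotent_toEnd_of_mem_rootSpace F H hi0.neg hy
      set h := (rootSystem H).coroot i with hh
      let D : Module.End ℂ F := LieModule.toEnd ℂ H F h - lam h • 1
      have hD : ∀ w, D w = ⁅(h : 𝔤), w⁆ - (n : ℂ) • w := fun w ↦ by rw [← hn]; rfl
      have hDG : ∀ w ∈ genWeightSpace F (lam : H → ℂ), D w ∈ genWeightSpace F (lam : H → ℂ) :=
        fun w hw ↦ sub_mem (LieSubmodule.lie_mem _ hw) (Submodule.smul_mem _ _ hw)
      have hsq : ∀ w ∈ genWeightSpace F (lam : H → ℂ), D (D w) = 0 → D w = 0 := by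
        intro w hw h0
        rw [hD, sub_eq_zero]
        refine lie_h_eq_smul_of_sq ht hnil (hraise i hi e he w hw) ?_
        rwa [hD, hD, sub_eq_zero] at h0
      obtain ⟨k, hk⟩ := (LieModule.mem_genWeightSpace F (lam : H → ℂ) w).1 hw h
      -- Since `D` preserves the generalized weight space, the case `D ^ 2` from `hsq` bootstraps to
      -- every power.
      have hpow : ∀ k, ∀ w ∈ genWeightSpace F (lam : H → ℂ), (D ^ k) w = 0 → D w = 0 := by
        intro k
        induction k with
        | zero =>
          intro w _ h0
          have : w = 0 := h0
          rw [this, map_zero]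
        | succ k ih =>
          intro w hw h0
          rw [pow_succ] at h0
          exact hsq w hw (ih (D w) (hDG w hw) h0)
      have := hpow k w hw hk
      rwa [hD, sub_eq_zero, ← hn] at this
    have hspan : Submodule.span ℂ ((rootSystem H).coroot '' b.support) = ⊤ := by
      rw [RootPairing.Base.span_coroot_support]
      exact RootPairing.IsRootSystem.span_coroot_eq_top
    have hall : ∀ h : H, ⁅(h : 𝔤), w⁆ = lam h • w := by
      intro h
      have hmem : h ∈ Submodule.span ℂ ((rootSystem H).coroot '' b.support) := hspan ▸ trivial
      induction hmem using Submodule.span_induction with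
      | mem h hh =>
        obtain ⟨i, hi, rfl⟩ := hh
        exact hsimple i hi
      | zero => simp
      | add x y _ _ hx hy =>
        rw [show ((x + y : H) : 𝔤) = x + y from rfl, add_lie, hx, hy, map_add, add_smul]
      | smul c x _ hx => rw [show ((c • x : H) : 𝔤) = c • (x : 𝔤) from rfl, smul_lie, hx, map_smul, smul_assoc]
    intro h
    rw [algebraMap_smul]
    exact congrArg Subtype.val (hall h)
  let g : F →ₗ⁅ℂ, H⁆ V.obj :=
    { F.toSubmodule.subtype with
      map_lie' := fun {x m} ↦ rfl }
  have hsplit : (⟨v, hvF⟩ : F) ∈ genWeightSpace F (lam : H → ℂ) ⊔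
      ⨆ χ : H → ℂ, ⨆ _ : χ ≠ lam, genWeightSpace F χ := by
    have h1 : (⟨v, hvF⟩ : F) ∈ ⨆ χ : H → ℂ, genWeightSpace F χ := by
      rw [LieModule.iSup_genWeightSpace_eq_top ℂ H F]
      exact LieSubmodule.mem_top _
    refine (iSup_le fun χ ↦ ?_ : (⨆ χ : H → ℂ, genWeightSpace F χ) ≤ _) h1
    by_cases h : χ = lam
    · exact h ▸ le_sup_left
    · exact le_sup_of_le_right (le_iSup₂_of_le χ h le_rfl)
  obtain ⟨w₀, hw₀, w₁, hw₁, hw⟩ := (LieSubmodule.mem_sup _ _ _).1 hsplit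
  refine ⟨w₀, hwt w₀ hw₀, w₁, ?_, congrArg Subtype.val hw⟩
  have h1 : g w₁ ∈ LieSubmodule.map g (⨆ χ : H → ℂ, ⨆ _ : χ ≠ lam, genWeightSpace F χ) :=
    LieSubmodule.mem_map_of_mem hw₁
  simp only [LieSubmodule.map_iSup] at h1
  exact iSup₂_mono (fun χ _ ↦ LieModule.map_genWeightSpace_le g) h1

/-- Surjections in `I_A^λ` are surjective on the weight spaces of weight `λ`. -/
lemma exists_mem_weightSpace_map_eq (hlam : IsDominantIntegral b lam) {V V' : BoundedCat b A lam}
    (f : V.obj →ₗ[Env 𝔤 A] V'.obj) (hf : Function.Surjective f) {v' : V'.obj}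
    (hv' : v' ∈ weightSpace H A V'.obj lam) : ∃ v ∈ weightSpace H A V.obj lam, f v = v' := by
  let i1 := lieRingModule (𝔤 := 𝔤) (A := A) V.obj
  have i2 := lieModule (𝔤 := 𝔤) (A := A) V.obj
  let i3 := lieRingModule (𝔤 := 𝔤) (A := A) V'.obj
  have i4 := lieModule (𝔤 := 𝔤) (A := A) V'.obj
  obtain ⟨v, rfl⟩ := hf v'
  obtain ⟨v₀, hv₀, v₁, hv₁, rfl⟩ := exists_mem_weightSpace_add hlam V v
  refine ⟨v₀, hv₀, ?_⟩
  let g : V.obj →ₗ⁅ℂ, H⁆ V'.obj :=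
    { f.restrictScalars ℂ with
      map_lie' := fun {x m} ↦ map_smul f (cur (x : 𝔤) 1) m }
  -- The vector `f v₁` lies in the sum of the other generalized weight spaces. It also equals `v' -
  -- f v₀`, which has weight `λ`, so it is zero and `v₀` is the required lift.
  have h1 : f v₁ ∈ ⨆ χ : H → ℂ, ⨆ _ : χ ≠ lam, genWeightSpace V'.obj χ := by
    have : g v₁ ∈ LieSubmodule.map g (⨆ χ : H → ℂ, ⨆ _ : χ ≠ lam, genWeightSpace V.obj χ) :=
      LieSubmodule.mem_map_of_mem hv₁
    simp only [LieSubmodule.map_iSup] at this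
    exact iSup₂_mono (fun χ _ ↦ LieModule.map_genWeightSpace_le g) this
  have h2 : f v₁ ∈ genWeightSpace V'.obj (lam : H → ℂ) := by
    refine LieModule.weightSpace_le_genWeightSpace V'.obj _ ?_
    rw [LieModule.mem_weightSpace]
    have h3 := sub_mem hv' (map_mem_weightSpace f hv₀)
    rw [map_add, add_sub_cancel_left] at h3
    exact fun h ↦ (h3 h).trans (algebraMap_smul _ _ _)
  have hind := LieModule.iSupIndep_genWeightSpace ℂ H V'.obj (lam : H → ℂ)
  rw [disjoint_iff] at hind
  have h4 : f v₁ ∈ genWeightSpace V'.obj (lam : H → ℂ) ⊓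
      ⨆ χ : H → ℂ, ⨆ _ : χ ≠ lam, genWeightSpace V'.obj χ := ⟨h2, h1⟩
  rw [hind, LieSubmodule.mem_bot] at h4
  rw [map_add, h4, add_zero]

end WeightLifting

/-! ### The vanishing condition and the counit -/

section Counit

variable {𝔤 : Type u} [LieRing 𝔤] [LieAlgebra ℂ 𝔤] [FiniteDimensional ℂ 𝔤]
  [LieAlgebra.IsSimple ℂ 𝔤] {H : LieSubalgebra ℂ 𝔤} [H.IsCartanSubalgebra]
  {b : (rootSystem H).Base} {A : Type u} [CommRing A] [Algebra ℂ A] {lam : Module.Dual ℂ H}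

lemma hom_injective_of_mono {X Y : BoundedCat b A lam} (f : X ⟶ Y) [Mono f] :
    Function.Injective f.hom.hom :=
  have := (boundedIntegrable b A lam).preservesMonomorphisms_ι_of_isNormalEpiCategory
  (ModuleCat.mono_iff_injective _).1 (inferInstanceAs (Mono ((boundedIntegrable b A lam).ι.map f)))

lemma hom_surjective_of_epi {X Y : BoundedCat b A lam} (f : X ⟶ Y) [Epi f] :
    Function.Surjective f.hom.hom :=
  have := (boundedIntegrable b A lam).preservesEpimorphisms_ι_of_isNormalMonoCategory
  (ModuleCat.epi_iff_surjective _).1 (inferInstanceAs (Epi ((boundedIntegrable b A lam).ι.map f)))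

variable {M : ModuleCat.{u} (ALam b A lam)}

lemma weylObj_hom_eq_zero {U : ModuleCat.{u} (Env 𝔤 A)} (hU : weightSpace H A U lam = ⊥)
    (f : weylObj b A lam M →ₗ[Env 𝔤 A] U) : f = 0 := by
  refine weylObj_hom_ext fun m ↦ ?_
  have h := map_mem_weightSpace f (topVec_mem_weightSpace m)
  rw [hU, Submodule.mem_bot] at h
  exact h

/-- The map `𝐑_A^λ V → 𝐑_A^λ V'` induced by `V → V'`. -/
def restrMap {V V' : BoundedCat b A lam} (f : V ⟶ V') :
    weightSpace H A V.obj lam →ₗ[ALam b A lam] weightSpace H A V'.obj lam where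
  toFun v := ⟨f.hom.hom v.1, map_mem_weightSpace f.hom.hom v.2⟩
  map_add' v w := Subtype.ext (map_add f.hom.hom v.1 w.1)
  map_smul' c v := by
    obtain ⟨c, rfl⟩ := Ideal.Quotient.mk_surjective c
    exact Subtype.ext (map_smul f.hom.hom (c : Env 𝔤 A) v.1)

/-- By adjunction, a section out of `𝐖 M` is determined on the vectors `w_λ ⊗ m`, so it is enough to
lift these to `E_λ` in an `𝐀_λ`-linear way. -/
lemma exists_section_of_lift {V E : BoundedCat b A lam} (e : V.obj ≅ weylObj b A lam M)
    (g : E ⟶ V) (φ : M →ₗ[ALam b A lam] restrObj E)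
    (hφ : ∀ m, g.hom.hom (Subtype.val (φ m)) = e.inv.hom (topVec M m)) :
    ∃ s : V ⟶ E, s ≫ g = 𝟙 V := by
  refine ⟨ObjectProperty.homMk (e.hom ≫ ModuleCat.ofHom (weylDesc φ)), ?_⟩
  have h1 : ModuleCat.ofHom (weylDesc φ) ≫ g.hom = e.inv := by
    ext1
    exact weylObj_hom_ext fun m ↦ (congrArg g.hom.hom (weylDesc_topVec φ m)).trans (hφ m)
  apply ObjectProperty.hom_ext
  exact (Category.assoc _ _ _).trans ((congrArg (e.hom ≫ ·) h1).trans e.hom_inv_id)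

/-- Exactness of `𝐑` and `U_λ = 0` make `E_λ → V_λ` bijective; its inverse supplies the lift of `M →
V_λ`. -/
lemma exists_section_of_iso (hlam : IsDominantIntegral b lam) {V E U : BoundedCat b A lam}
    (e : V.obj ≅ weylObj b A lam M) (hU : weightSpace H A U.obj lam = ⊥) (f : U ⟶ E) (g : E ⟶ V)
    (w : f ≫ g = 0) (hS : (ShortComplex.mk f g w).ShortExact) : ∃ s : V ⟶ E, s ≫ g = 𝟙 V := by
  have : Epi g := hS.epi_g
  have : Mono f := hS.mono_f
  have hinj : Function.Injective (restrMap g) := by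
    rw [injective_iff_map_eq_zero]
    intro x hx
    have hx' : g.hom.hom x.1 = 0 := congrArg Subtype.val hx
    have : Mono (ModuleCat.ofHom (LinearMap.ker g.hom.hom).subtype) :=
      (ModuleCat.mono_iff_injective _).2 (Submodule.subtype_injective _)
    -- A vector of `E_λ` killed by `g` lives in the kernel `K`. By exactness `K` maps to `U` over
    -- `E`, and the image has weight `λ` in `U`, hence is zero.
    let K : BoundedCat b A lam := ⟨ModuleCat.of (Env 𝔤 A) (LinearMap.ker g.hom.hom),
      (boundedIntegrable b A lam).prop_of_mono
        (ModuleCat.ofHom (LinearMap.ker g.hom.hom).subtype) E.property⟩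
    let k : K ⟶ E := ObjectProperty.homMk (ModuleCat.ofHom (LinearMap.ker g.hom.hom).subtype)
    have hk : k ≫ g = 0 := by
      ext y
      exact y.2
    obtain ⟨l, hl⟩ : ∃ l : K ⟶ U, l ≫ f = k := ⟨hS.exact.lift k hk, hS.exact.lift_f k hk⟩
    let x' : K.obj := ⟨x.1, hx'⟩
    have hx'' : x' ∈ weightSpace H A K.obj lam := fun h ↦ Subtype.ext (x.2 h)
    have h0 := map_mem_weightSpace l.hom.hom hx''
    rw [hU, Submodule.mem_bot] at h0
    refine Subtype.ext ?_
    have h1 : f.hom.hom (l.hom.hom x') = x.1 :=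
      congrArg (fun φ : K ⟶ E ↦ φ.hom.hom x') hl
    rw [h0, map_zero] at h1
    exact h1.symm
  have hsurj : Function.Surjective (restrMap g) := by
    rintro ⟨v, hv⟩
    obtain ⟨x, hx, rfl⟩ := exists_mem_weightSpace_map_eq hlam g.hom.hom
      (hom_surjective_of_epi g) hv
    exact ⟨⟨x, hx⟩, rfl⟩
  let ρ := LinearEquiv.ofBijective (restrMap g) ⟨hinj, hsurj⟩
  let φ : M →ₗ[ALam b A lam] restrObj E :=
    ρ.symm.toLinearMap ∘ₗ weylAdjoint (V := V) e.inv.hom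
  have hφ (m : M) : g.hom.hom (Subtype.val (φ m)) =
      e.inv.hom (topVec M m) :=
    congrArg Subtype.val (ρ.apply_symm_apply (weylAdjoint (V := V) e.inv.hom m))
  exact exists_section_of_lift e g φ hφ

/-- The modules `𝐖_A^λ M` satisfy the vanishing condition. -/
lemma homExtVanish_of_iso (hlam : IsDominantIntegral b lam) {V : BoundedCat b A lam}
    (e : V.obj ≅ weylObj b A lam M) : HomExtVanish V := by
  refine fun U hU ↦ ⟨⟨fun f g ↦ ?_⟩, ?_⟩
  · have h : ∀ f : V ⟶ U, e.inv ≫ f.hom = 0 := fun f ↦ by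
      ext1
      exact weylObj_hom_eq_zero hU _
    apply ObjectProperty.hom_ext
    rw [← cancel_epi e.inv, h f, h g]
  · exact Abelian.Ext.subsingleton_of_forall_exists_section V U fun E f g w hS ↦
      exists_section_of_iso hlam e hU f g w hS

/-- The counit `𝐖_A^λ 𝐑_A^λ V → V`. -/
def weylCounit (V : BoundedCat b A lam) :
    weylObj b A lam (restrObj V) →ₗ[Env 𝔤 A] V.obj := weylDesc LinearMap.id

lemma weylCounit_topVec {V : BoundedCat b A lam} (v : weightSpace H A V.obj lam) :
    weylCounit V (topVec (restrObj V) v) = v :=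
  weylDesc_topVec (M := restrObj V) LinearMap.id v

/-- The image of the counit contains `V_λ`, and weight-`λ` vectors of the cokernel lift to `V_λ`. So
the cokernel has no weight `λ`, and the Hom condition kills the projection onto it. -/
lemma weylCounit_surjective (hlam : IsDominantIntegral b lam) {V : BoundedCat b A lam}
    (hV : HomExtVanish V) : Function.Surjective (weylCounit V) := by
  let R := LinearMap.range (weylCounit V)
  have : Epi (ModuleCat.ofHom R.mkQ) := (ModuleCat.epi_iff_surjective _).2 R.mkQ_surjective
  let Q : BoundedCat b A lam := ⟨ModuleCat.of (Env 𝔤 A) (V.obj ⧸ R),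
    (boundedIntegrable b A lam).prop_of_epi (ModuleCat.ofHom R.mkQ) V.property⟩
  let π : V ⟶ Q := ObjectProperty.homMk (ModuleCat.ofHom R.mkQ)
  have hQ : weightSpace H A Q.obj lam = ⊥ := by
    rw [eq_bot_iff]
    intro q hq
    obtain ⟨v, hv, rfl⟩ := exists_mem_weightSpace_map_eq hlam π.hom.hom R.mkQ_surjective hq
    exact (Submodule.mem_bot _).2
      ((Submodule.Quotient.mk_eq_zero R).2 ⟨_, weylCounit_topVec ⟨v, hv⟩⟩)
  have := (hV Q hQ).1
  have h0 : π = 0 := Subsingleton.elim _ _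
  intro v
  have h1 : π.hom.hom v = 0 := by rw [h0]; rfl
  exact (Submodule.Quotient.mk_eq_zero R).1 h1

lemma isIso_weylCounit (hlam : IsDominantIntegral b lam) {V : BoundedCat b A lam}
    (hV : HomExtVanish V) : IsIso (ModuleCat.ofHom (weylCounit V)) := by
  let W : BoundedCat b A lam := ⟨weylObj b A lam (restrObj V), boundedIntegrable_weylObj hlam _⟩
  let ε : W ⟶ V := ObjectProperty.homMk (ModuleCat.ofHom (weylCounit V))
  have : Epi ((boundedIntegrable b A lam).ι.map ε) :=
    (ModuleCat.epi_iff_surjective _).2 (weylCounit_surjective hlam hV)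
  have : Epi ε := (boundedIntegrable b A lam).ι.epi_of_epi_map this
  let S := ShortComplex.mk _ _ (Limits.kernel.condition ε)
  have hS : S.ShortExact :=
    { exact := ShortComplex.exact_of_f_is_kernel _ (Limits.kernelIsKernel ε) }
  -- Vectors of weight `λ` in `𝐖 𝐑 V` have the form `w_λ ⊗ v`, and the counit sends this to `v`;
  -- none but zero lies in the kernel.
  have hK : weightSpace H A S.X₁.obj lam = ⊥ := by
    rw [eq_bot_iff]
    intro x hx
    have h1 : S.f.hom.hom x ∈ wtSpace H (weylObj b A lam (restrObj V)) lam :=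
      map_mem_weightSpace S.f.hom.hom hx
    rw [wtSpace_weylObj] at h1
    obtain ⟨m, hm⟩ := h1
    have h2 : ε.hom.hom (S.f.hom.hom x) = 0 :=
      congrArg (fun φ : S.X₁ ⟶ V ↦ φ.hom.hom x) S.zero
    have h3 : weylCounit V (topVec (restrObj V) m) = 0 := by
      rw [hm]
      exact h2
    have h4 : m = 0 := Subtype.ext ((weylCounit_topVec m).symm.trans h3)
    have h5 : S.f.hom.hom x = 0 := by
      rw [← hm, h4]
      exact TensorProduct.tmul_zero _ _
    exact (Submodule.mem_bot _).2
      (hom_injective_of_mono S.f (h5.trans (map_zero _).symm))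
  obtain ⟨s, hs⟩ := Abelian.Ext.exists_section_of_subsingleton hS (hV _ hK).2
  let σ := ShortComplex.Splitting.ofExactOfSection _ hS.exact s hs inferInstance
  -- The retraction maps a module generated in weight `λ` to one without that weight. The splitting
  -- identity then reduces to `ε ≫ s = 𝟙 W`.
  have hr : σ.r = 0 := by
    apply ObjectProperty.hom_ext
    ext1
    exact weylObj_hom_eq_zero hK _
  have h1 : ε ≫ s = 𝟙 W := by
    have := σ.id
    rw [hr, Limits.zero_comp, zero_add] at this
    exact this
  exact ⟨⟨s.hom, congrArg (·.hom) h1, congrArg (·.hom) hs⟩⟩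

/-- If `V ≅ 𝐖_A^λ M` then `M ≅ 𝐑_A^λ V`. -/
lemma nonempty_linearEquiv_restrObj {V : BoundedCat b A lam} (e : V.obj ≅ weylObj b A lam M) :
    Nonempty (M ≃ₗ[ALam b A lam] restrObj V) := by
  refine ⟨LinearEquiv.ofBijective (weylAdjoint (V := V) e.inv.hom) ⟨fun m n h ↦ ?_, ?_⟩⟩
  · exact topVec_injective (e.toLinearEquiv.symm.injective (congrArg Subtype.val h))
  · rintro ⟨v, hv⟩
    have h1 : e.hom.hom v ∈ wtSpace H (weylObj b A lam M) lam := map_mem_weightSpace e.hom.hom hv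
    rw [wtSpace_weylObj] at h1
    obtain ⟨m, hm⟩ := h1
    refine ⟨m, Subtype.ext ?_⟩
    change e.inv.hom (topVec M m) = v
    rw [hm]
    exact e.toLinearEquiv.symm_apply_apply v

end Counit

end
end CurrentAlgebra

theorem mainTheorem1 {𝔤 : Type u} [LieRing 𝔤] [LieAlgebra ℂ 𝔤] [FiniteDimensional ℂ 𝔤]
    [LieAlgebra.IsSimple ℂ 𝔤] (H : LieSubalgebra ℂ 𝔤) [H.IsCartanSubalgebra]
    (b : (LieAlgebra.IsKilling.rootSystem H).Base) (A : Type u) [CommRing A] [Algebra ℂ A]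
    (lam : Module.Dual ℂ H) (hlam : CurrentAlgebra.IsDominantIntegral b lam)
    (V : CurrentAlgebra.BoundedCat b A lam) :
    (Nonempty (V.obj ≅ CurrentAlgebra.weylObj b A lam (CurrentAlgebra.restrObj V)) ↔
      CurrentAlgebra.HomExtVanish V) ∧
    ((∃ M : ModuleCat.{u} (CurrentAlgebra.ALam b A lam),
        Nonempty (V.obj ≅ CurrentAlgebra.weylObj b A lam M)) ↔
      CurrentAlgebra.HomExtVanish V) ∧
    ((∃ M : ModuleCat.{u} (CurrentAlgebra.ALam b A lam),
        IsSimpleModule (CurrentAlgebra.ALam b A lam) M ∧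
          Nonempty (V.obj ≅ CurrentAlgebra.weylObj b A lam M)) ↔
      IsSimpleModule (CurrentAlgebra.ALam b A lam) (CurrentAlgebra.restrObj V) ∧
        CurrentAlgebra.HomExtVanish V) := by
  open CurrentAlgebra in
  have hcounit : HomExtVanish V →
      Nonempty (V.obj ≅ weylObj b A lam (restrObj V)) := fun hV ↦
    have := isIso_weylCounit hlam hV
    ⟨(asIso (ModuleCat.ofHom (weylCounit V))).symm⟩
  refine ⟨⟨fun ⟨e⟩ ↦ CurrentAlgebra.homExtVanish_of_iso hlam e, hcounit⟩,
    ⟨fun ⟨M, ⟨e⟩⟩ ↦ CurrentAlgebra.homExtVanish_of_iso hlam e, fun hV ↦ ⟨_, hcounit hV⟩⟩,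
    fun ⟨M, hM, ⟨e⟩⟩ ↦ ⟨?_, CurrentAlgebra.homExtVanish_of_iso hlam e⟩,
    fun ⟨hV, hV'⟩ ↦ ⟨_, hV, hcounit hV'⟩⟩
  -- Simplicity passes from `M` to `𝐑 V` because the unit identifies the two.
  obtain ⟨φ⟩ := CurrentAlgebra.nonempty_linearEquiv_restrObj e
  exact IsSimpleModule.congr φ.symm
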